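/- Let $n\ge 2$, let $(M,g)$ be an oriented Riemannian spin manifold of dimension $2n$ and let $S\to M$ be its complex spinor bundle (of rank $2^n$), with Clifford multiplication $\gamma:TM\to\mathrm{End}(S)$, $XY+YX=-2g(X,Y)$, and charge conjugation $C$, i.e. a smooth non-degenerate complex bilinear form on $S$ with $C(\varphi,\psi)=\Delta_0C(\psi,\varphi)$ and $C(\varphi,X\psi)=\Delta_1C(\psi,X\varphi)$ for signs $\Delta_0,\Delta_1\in\{\pm1\}$. For complex tangent vectors put $\gamma_{a_1\ldots a_k}=\gamma_{[a_1}\cdots\gamma_{a_k]}$ (skew-symmetrization with weight $1/k!$). Let $\gamma^*$ be the chirality operator: in a positively oriented orthonormal frame, $\gamma^*=\gamma^1\cdots\gamma^{2n}$ if $n$ is even and $\gamma^*=i\,\gamma^1\cdots\gamma^{2n}$ if $n$ is odd. Let $D$ be a smooth complex linear connection on $S$ with curvature $R\in\Omega^2(M)\otimes\Gamma\,\mathrm{End}(S)$. Let $\eta\in\Gamma S$ be a pure spinor, i.e. at each point $x$ the null space $N_x=\{X\in T_xM\otimes\mathbb C\mid X\eta=0\}$ has dimension $n$; the complex structure defined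 by $\eta$ is the one with $T^{1,0}_xM=N_x$. At each point let $e_1,\ldots,e_n$ be any basis of $N_x$ ("unbarred indices"), and put $\gamma_a=\gamma(e_a)$, $R_{ab}=R(e_a,e_b)$, where $\gamma$ and $R$ are extended complex (bi)linearly. Then $\gamma^*\eta=w_\eta\eta$ with a sign $w_\eta\in\{\pm1\}$ at each point, and $$\mathfrak B(R;\eta,\eta):=\sum_{\mu,\nu}\gamma^\mu\eta\wedge\gamma^\nu\eta\cdot R_{\mu\nu}=0$$ (sum over a full frame $e_\mu$ of $TM$) if and only if $$\sum_{a_1,\ldots,a_n=1}^{n}\varepsilon^{a_1\ldots a_n}\,\gamma_{a_1\ldots a_{n-2}}\bigl(\mathbf 1-(-1)^nw_\eta\gamma^*\bigr)\cdot R_{a_{n-1}a_n}=0 .$$ This holds at each point, hence also for the vanishing on all of $M$, and it holds for both of the following meanings of the product "$\cdot$": (i) Both expressions are vector fields on the supermanifold with algebra of functions $\Gamma\Lambda S$: an endomorphism $\Phi$ of $S$ is the derivation of $\Lambda S$ which extends $\Phi:S\to S$, and it is multiplied by an element $\alpha\in\Lambda^2S$, so that $\alpha\cdot\Phi$ is given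 by $\xi\mapsto\alpha\wedge\Phi\xi$, $S\to\Lambda^3S$. Here the endomorphism $\gamma_{a_1\ldots a_{n-2}}(\mathbf 1-(-1)^nw_\eta\gamma^*)$ is viewed in $\Lambda^2S$ by the linear map $\mathrm{End}(S)\to\Lambda^2S$ that sends $\varphi\otimes C(\psi,\cdot)$ to $\varphi\wedge\psi$. (ii) "$\cdot$" is the tensor product, in $\Lambda S\otimes\mathrm{End}(S)$ for the first expression and in $\mathrm{End}(S)\otimes\mathrm{End}(S)$ for the second. -/

import Mathlib

open Bundle Module
open scoped Manifold ContDiff TensorProduct Topology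

noncomputable section

/-! ### Spinor algebra at a point

`V` is a Euclidean vector space (a tangent space), `W` a complex vector space (a fibre of the
spinor bundle) and `γ : V → End W` the Clifford multiplication. -/

section Pointwise

variable {V : Type*} [NormedAddCommGroup V] [InnerProductSpace ℝ V]
  {W : Type*} [AddCommGroup W] [Module ℂ W]

/-- The complex linear extension `V ⊗ ℂ → End W` of the Clifford multiplication. -/
def cliffordC (γ : V →ₗ[ℝ] Module.End ℂ W) : ℂ ⊗[ℝ] V →ₗ[ℂ] Module.End ℂ W :=
  γ.liftBaseChange ℂ

/-- `γ_{a₁ … a_k} = γ_{[a₁} ⋯ γ_{a_k]}`, the skew-symmetrized product (with weight `1 / k!`) of the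
Clifford multiplications by the complexified vectors `v₁, …, v_k`. -/
def gammaSkew (γ : V →ₗ[ℝ] Module.End ℂ W) {k : ℕ} (v : Fin k → ℂ ⊗[ℝ] V) : Module.End ℂ W :=
  ((k.factorial : ℂ))⁻¹ • ∑ σ : Equiv.Perm (Fin k),
    ((Equiv.Perm.sign σ : ℤ) : ℂ) • (List.ofFn fun i => cliffordC γ (v (σ i))).prod

/-- The null space `{X ∈ V ⊗ ℂ | X η = 0}` of a spinor. -/
def nullSpace (γ : V →ₗ[ℝ] Module.End ℂ W) (η : W) : Submodule ℂ (ℂ ⊗[ℝ] V) :=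
  LinearMap.ker ((cliffordC γ).flip η)

/-- A spinor in dimension `2 n` is pure if its null space has the maximal dimension, namely `n`. -/
def IsPureSpinor (n : ℕ) (γ : V →ₗ[ℝ] Module.End ℂ W) (η : W) : Prop :=
  Module.finrank ℂ (nullSpace γ η) = n

/-- The chirality operator `γ^*` in Euclidean dimension `2 n`, computed in a (positively oriented)
orthonormal basis `b`: it is `γ¹ ⋯ γ²ⁿ` if `2 n ≡ 0 mod 4` and `i γ¹ ⋯ γ²ⁿ` if `2 n ≡ 2 mod 4`. -/
def chiralityOp {n : ℕ} (γ : V →ₗ[ℝ] Module.End ℂ W)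
    (b : OrthonormalBasis (Fin (2 * n)) ℝ V) : Module.End ℂ W :=
  (if Even n then (1 : ℂ) else Complex.I) • (List.ofFn fun i => γ (b i)).prod

open Classical in
/-- The sign `w_η` of a chiral spinor: `1` if `γ^* η = η` and `-1` otherwise. -/
def chiralitySign (gs : Module.End ℂ W) (η : W) : ℂ :=
  if gs η = η then 1 else -1

/-- The complex bilinear extension `R_{ab} = R(e_a, e_b)` of an `End W`-valued bilinear form. -/
def curvC (R : V →ₗ[ℝ] V →ₗ[ℝ] Module.End ℂ W) :
    ℂ ⊗[ℝ] V →ₗ[ℂ] ℂ ⊗[ℝ] V →ₗ[ℂ] Module.End ℂ W :=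
  (((LinearMap.liftBaseChangeEquiv (R := ℝ) (M := V) (N := Module.End ℂ W) ℂ).toLinearMap.restrictScalars
    ℝ) ∘ₗ R).liftBaseChange ℂ

/-- The product of a form `α ∈ Λ W` with an endomorphism `Φ`, as a vector field on the
supermanifold with functions `Λ W`. An endomorphism `Φ` is the derivation of `Λ W` extending
`Φ : W → W ⊆ Λ W`, and `owedge α Φ` is `α` times this derivation. A vector field in `Λ W ⊗ W^*` is
identified with the linear map `W → Λ W` that it induces on the generators `W` of `Λ W`. -/
def owedge (α : ExteriorAlgebra ℂ W) (Φ : Module.End ℂ W) : W →ₗ[ℂ] ExteriorAlgebra ℂ W :=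
  LinearMap.mulLeft ℂ α ∘ₗ ExteriorAlgebra.ι ℂ ∘ₗ Φ

/-- The identification of an endomorphism `Φ` with an element of `W ⊗ W` by the charge conjugation
`C`, followed by the projection to `Λ² W`: it is `Φ_i^j C^{ik} θ_j ∧ θ_k`, where `θ` is a basis of
`W` and `C^{ij} C_{jk} = δ^i_k`. It is linear in `Φ`, and it sends `φ ⊗ C(ψ, ·)` to `φ ∧ ψ`. -/
def twoVector [FiniteDimensional ℂ W] (C : LinearMap.BilinForm ℂ W) (hC : C.Nondegenerate)
    (Φ : Module.End ℂ W) : ExteriorAlgebra ℂ W :=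
  ∑ i, ExteriorAlgebra.ι ℂ (Φ (Module.finBasis ℂ W i)) *
    ExteriorAlgebra.ι ℂ (C.dualBasis hC (Module.finBasis ℂ W) i)

/-- `𝔅(R; φ, ψ) = γ^μ φ ∧ γ^ν ψ · R_{μν}` as a vector field on the supermanifold. -/
def bracketB [FiniteDimensional ℝ V] (γ : V →ₗ[ℝ] Module.End ℂ W)
    (R : V →ₗ[ℝ] V →ₗ[ℝ] Module.End ℂ W) (φ ψ : W) : W →ₗ[ℂ] ExteriorAlgebra ℂ W :=
  ∑ μ, ∑ ν, owedge
    (ExteriorAlgebra.ι ℂ (γ (stdOrthonormalBasis ℝ V μ) φ) *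
      ExteriorAlgebra.ι ℂ (γ (stdOrthonormalBasis ℝ V ν) ψ))
    (R (stdOrthonormalBasis ℝ V μ) (stdOrthonormalBasis ℝ V ν))

/-- `γ^μ φ ∧ γ^ν ψ ⊗ R_{μν}` as an element of `Λ W ⊗ End W`, i.e. before the form part and the
endomorphism part are multiplied. -/
def bracketBTensor [FiniteDimensional ℝ V] (γ : V →ₗ[ℝ] Module.End ℂ W)
    (R : V →ₗ[ℝ] V →ₗ[ℝ] Module.End ℂ W) (φ ψ : W) :
    ExteriorAlgebra ℂ W ⊗[ℂ] Module.End ℂ W :=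
  ∑ μ, ∑ ν,
    (ExteriorAlgebra.ι ℂ (γ (stdOrthonormalBasis ℝ V μ) φ) *
      ExteriorAlgebra.ι ℂ (γ (stdOrthonormalBasis ℝ V ν) ψ)) ⊗ₜ[ℂ]
    (R (stdOrthonormalBasis ℝ V μ) (stdOrthonormalBasis ℝ V ν))

/-- For a permutation `σ` of the indices `1, …, n`, i.e. `(a₁, …, a_n) = (σ 1, …, σ n)`, the
endomorphism `γ_{a₁ … a_{n-2}} (1 - (-1)^n w γ^*)` in the frame `e`. -/
def gammaFactor {n : ℕ} (γ : V →ₗ[ℝ] Module.End ℂ W) (gs : Module.End ℂ W) (w : ℂ)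
    (e : Fin n → ℂ ⊗[ℝ] V) (σ : Equiv.Perm (Fin n)) : Module.End ℂ W :=
  gammaSkew γ (fun i : Fin (n - 2) => e (σ (Fin.castLE (Nat.sub_le n 2) i))) *
    (1 - ((-1 : ℂ) ^ n * w) • gs)

/-- For a permutation `σ` of the indices, `(a₁, …, a_n) = (σ 1, …, σ n)`, the component
`R_{a_{n-1} a_n}` in the frame `e`. -/
def curvFactor {n : ℕ} (hn : 2 ≤ n) (R : V →ₗ[ℝ] V →ₗ[ℝ] Module.End ℂ W)
    (e : Fin n → ℂ ⊗[ℝ] V) (σ : Equiv.Perm (Fin n)) : Module.End ℂ W :=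
  curvC R (e (σ ⟨n - 2, by omega⟩)) (e (σ ⟨n - 1, by omega⟩))

/-- `ε^{a₁ … a_n} γ_{a₁ … a_{n-2}} (1 - (-1)^n w γ^*) · R_{a_{n-1} a_n}` as a vector field on the
supermanifold; the first factor is viewed in `Λ² W` by means of `C`. Only the permutations
contribute to the sum over `a₁, …, a_n`. -/
def epsilonSum {n : ℕ} (hn : 2 ≤ n) [FiniteDimensional ℂ W] (C : LinearMap.BilinForm ℂ W)
    (hC : C.Nondegenerate) (γ : V →ₗ[ℝ] Module.End ℂ W) (gs : Module.End ℂ W) (w : ℂ)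
    (R : V →ₗ[ℝ] V →ₗ[ℝ] Module.End ℂ W) (e : Fin n → ℂ ⊗[ℝ] V) :
    W →ₗ[ℂ] ExteriorAlgebra ℂ W :=
  ∑ σ : Equiv.Perm (Fin n), ((Equiv.Perm.sign σ : ℤ) : ℂ) •
    owedge (twoVector C hC (gammaFactor γ gs w e σ)) (curvFactor hn R e σ)

/-- `ε^{a₁ … a_n} γ_{a₁ … a_{n-2}} (1 - (-1)^n w γ^*) ⊗ R_{a_{n-1} a_n}` in `End W ⊗ End W`. -/
def epsilonSumTensor {n : ℕ} (hn : 2 ≤ n) (γ : V →ₗ[ℝ] Module.End ℂ W) (gs : Module.End ℂ W)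
    (w : ℂ) (R : V →ₗ[ℝ] V →ₗ[ℝ] Module.End ℂ W) (e : Fin n → ℂ ⊗[ℝ] V) :
    Module.End ℂ W ⊗[ℂ] Module.End ℂ W :=
  ∑ σ : Equiv.Perm (Fin n), ((Equiv.Perm.sign σ : ℤ) : ℂ) •
    (gammaFactor γ gs w e σ ⊗ₜ[ℂ] curvFactor hn R e σ)

end Pointwise

/-! ### Spinor bundles and connections -/

section Bundles

variable (n : ℕ) (M : Type*) [TopologicalSpace M]
  [ChartedSpace (EuclideanSpace ℝ (Fin (2 * n))) M] [IsManifold (𝓡 (2 * n)) ∞ M]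
  [RiemannianBundle (fun x : M => TangentSpace (𝓡 (2 * n)) x)]
  (F : Type*) [NormedAddCommGroup F] [NormedSpace ℂ F]
  (S : M → Type*) [∀ x, AddCommGroup (S x)] [∀ x, Module ℂ (S x)]
  [∀ x, TopologicalSpace (S x)]
  [TopologicalSpace (TotalSpace F S)] [FiberBundle F S]

/-- The structure of a spinor bundle of an (oriented) spin manifold `M` of dimension `2 n` on a
complex vector bundle `S`: the rank of `S` is `2 ^ n`, and there are a smooth Clifford
multiplication `TM → End S` with `X Y + Y X = -2 g(X, Y)` and a smooth nondegenerate bilinear form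
`C`, the charge conjugation, for which `C(φ, ψ)` and `C(φ, X ψ)` have the symmetries `Δ₀` and `Δ₁`.
(Such a `C` is spin-invariant: `C(X Y φ, ψ) = -C(φ, X Y ψ)` for orthogonal `X`, `Y`. Irreducible
Clifford module bundles with such a `C` are exactly the spinor bundles of spin structures.) -/
structure SpinorBundle where
  /-- The rank of the bundle is the dimension of the spin representation. -/
  rank_eq : Module.finrank ℂ F = 2 ^ n
  /-- The orientation of `M`. -/
  orientation : ∀ x : M, Orientation ℝ (TangentSpace (𝓡 (2 * n)) x) (Fin (2 * n))
  /-- Near every point there is a smooth positively oriented frame. -/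
  exists_oriented_frame : ∀ x : M, ∃ E : Fin (2 * n) → (y : M) → TangentSpace (𝓡 (2 * n)) y,
    (∀ i, ContMDiffAt (𝓡 (2 * n)) ((𝓡 (2 * n)).prod 𝓘(ℝ, EuclideanSpace ℝ (Fin (2 * n)))) ∞
      (fun y => TotalSpace.mk' (EuclideanSpace ℝ (Fin (2 * n))) y (E i y)) x) ∧
    ∀ᶠ y in 𝓝 x, ∃ b : Module.Basis (Fin (2 * n)) ℝ (TangentSpace (𝓡 (2 * n)) y),
      (∀ i, b i = E i y) ∧ b.orientation = orientation y
  /-- The Clifford multiplication. -/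
  γ : ∀ x : M, TangentSpace (𝓡 (2 * n)) x →ₗ[ℝ] Module.End ℂ (S x)
  clifford : ∀ (x : M) (X Y : TangentSpace (𝓡 (2 * n)) x),
    γ x X * γ x Y + γ x Y * γ x X = ((-2 * inner ℝ X Y : ℝ) : ℂ) • (1 : Module.End ℂ (S x))
  smooth_γ : ∀ (X : (x : M) → TangentSpace (𝓡 (2 * n)) x) (σ : (x : M) → S x),
    ContMDiff (𝓡 (2 * n)) ((𝓡 (2 * n)).prod 𝓘(ℝ, EuclideanSpace ℝ (Fin (2 * n)))) ∞
      (fun x => TotalSpace.mk' (EuclideanSpace ℝ (Fin (2 * n))) x (X x)) →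
    ContMDiff (𝓡 (2 * n)) ((𝓡 (2 * n)).prod 𝓘(ℝ, F)) ∞ (fun x => TotalSpace.mk' F x (σ x)) →
    ContMDiff (𝓡 (2 * n)) ((𝓡 (2 * n)).prod 𝓘(ℝ, F)) ∞
      (fun x => TotalSpace.mk' F x (γ x (X x) (σ x)))
  /-- The charge conjugation. -/
  C : ∀ x : M, LinearMap.BilinForm ℂ (S x)
  C_nondegenerate : ∀ x, (C x).Nondegenerate
  /-- The symmetry of `C`. -/
  Δ₀ : ℤˣ
  /-- The symmetry of `C(·, X ·)`. -/
  Δ₁ : ℤˣ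
  C_symm : ∀ (x : M) (φ ψ : S x), C x φ ψ = ((Δ₀ : ℤ) : ℂ) * C x ψ φ
  C_γ_symm : ∀ (x : M) (X : TangentSpace (𝓡 (2 * n)) x) (φ ψ : S x),
    C x φ (γ x X ψ) = ((Δ₁ : ℤ) : ℂ) * C x ψ (γ x X φ)
  smooth_C : ∀ φ ψ : (x : M) → S x,
    ContMDiff (𝓡 (2 * n)) ((𝓡 (2 * n)).prod 𝓘(ℝ, F)) ∞ (fun x => TotalSpace.mk' F x (φ x)) →
    ContMDiff (𝓡 (2 * n)) ((𝓡 (2 * n)).prod 𝓘(ℝ, F)) ∞ (fun x => TotalSpace.mk' F x (ψ x)) →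
    ContMDiff (𝓡 (2 * n)) 𝓘(ℝ, ℂ) ∞ (fun x => C x (φ x) (ψ x))

variable {n M F S}

/-- The chirality operator `γ^*` of a spinor bundle at a point. -/
def SpinorBundle.chirality (𝒮 : SpinorBundle n M F S) (hn : 2 ≤ n) (x : M) : Module.End ℂ (S x) :=
  chiralityOp (𝒮.γ x) ((𝒮.orientation x).finOrthonormalBasis (by omega)
    finrank_euclideanSpace_fin)

end Bundles

section Connections

variable (n : ℕ) (M : Type*) [TopologicalSpace M]
  [ChartedSpace (EuclideanSpace ℝ (Fin (2 * n))) M] [IsManifold (𝓡 (2 * n)) ∞ M]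
  (F : Type*) [NormedAddCommGroup F] [NormedSpace ℂ F]
  (S : M → Type*) [∀ x, AddCommGroup (S x)] [∀ x, Module ℂ (S x)]
  [∀ x, TopologicalSpace (S x)]
  [∀ x, IsTopologicalAddGroup (S x)] [∀ x, ContinuousSMul ℝ (S x)]
  [TopologicalSpace (TotalSpace F S)] [FiberBundle F S]
  [VectorBundle ℝ F S]

/-- A (smooth, complex linear) connection on the complex vector bundle `S`. -/
structure ComplexConnection extends CovariantDerivative (𝓡 (2 * n)) F S where
  smooth : CovariantDerivative.ContMDiffCovariantDerivative toCovariantDerivative ∞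
  complex_linear : ∀ (c : ℂ) (σ : (x : M) → S x) (x : M),
    MDifferentiableAt (𝓡 (2 * n)) ((𝓡 (2 * n)).prod 𝓘(ℝ, F))
      (fun y => TotalSpace.mk' F y (σ y)) x →
    ∀ v : TangentSpace (𝓡 (2 * n)) x, toFun (c • σ) x v = c • toFun σ x v

variable {n M F S}

/-- `D_X D_Y σ - D_Y D_X σ - D_{[X, Y]} σ` at the point `x`. -/
def curvatureAux (D : ComplexConnection n M F S) (X Y : (x : M) → TangentSpace (𝓡 (2 * n)) x)
    (σ : (x : M) → S x) (x : M) : S x :=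
  D.toFun (fun y => D.toFun σ y (Y y)) x (X x) - D.toFun (fun y => D.toFun σ y (X y)) x (Y x) -
    D.toFun σ x (VectorField.mlieBracket (𝓡 (2 * n)) X Y x)

end Connections

section Curvature

/-- The local extension of a vector `v` of the fibre at `x` to the section that is constant in the
preferred trivialization at `x` (and zero outside its domain). -/
def constExtend (𝕜 : Type*) [NontriviallyNormedField 𝕜] {B : Type*} [TopologicalSpace B]
    (F : Type*) [NormedAddCommGroup F] [NormedSpace 𝕜 F]
    {V : B → Type*} [∀ x, AddCommGroup (V x)] [∀ x, Module 𝕜 (V x)] [∀ x, TopologicalSpace (V x)]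
    [TopologicalSpace (TotalSpace F V)] [FiberBundle F V] [VectorBundle 𝕜 F V]
    {x : B} (v : V x) (y : B) : V y :=
  (trivializationAt F V x).symmₗ 𝕜 y (trivializationAt F V x ⟨x, v⟩).2

theorem constExtend_add {𝕜 : Type*} [NontriviallyNormedField 𝕜] {B : Type*} [TopologicalSpace B]
    {F : Type*} [NormedAddCommGroup F] [NormedSpace 𝕜 F]
    {V : B → Type*} [∀ x, AddCommGroup (V x)] [∀ x, Module 𝕜 (V x)] [∀ x, TopologicalSpace (V x)]
    [TopologicalSpace (TotalSpace F V)] [FiberBundle F V] [VectorBundle 𝕜 F V]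
    {x : B} (s t : V x) :
    constExtend 𝕜 F (s + t) = constExtend 𝕜 F s + constExtend 𝕜 F t := by
  have hx := FiberBundle.mem_baseSet_trivializationAt' (F := F) (E := V) x
  funext y
  simp only [constExtend, Pi.add_apply]
  rw [← map_add]
  congr 1
  exact ((trivializationAt F V x).linear 𝕜 hx).map_add s t

theorem constExtend_smul {𝕜 : Type*} [NontriviallyNormedField 𝕜] {B : Type*} [TopologicalSpace B]
    {F : Type*} [NormedAddCommGroup F] [NormedSpace 𝕜 F]
    {V : B → Type*} [∀ x, AddCommGroup (V x)] [∀ x, Module 𝕜 (V x)] [∀ x, TopologicalSpace (V x)]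
    [TopologicalSpace (TotalSpace F V)] [FiberBundle F V] [VectorBundle 𝕜 F V]
    {x : B} (c : 𝕜) (s : V x) :
    constExtend 𝕜 F (c • s) = c • constExtend 𝕜 F s := by
  have hx := FiberBundle.mem_baseSet_trivializationAt' (F := F) (E := V) x
  funext y
  simp only [constExtend, Pi.smul_apply]
  rw [← map_smul]
  congr 1
  exact ((trivializationAt F V x).linear 𝕜 hx).map_smul c s

theorem constExtend_self (𝕜 : Type*) [NontriviallyNormedField 𝕜] {B : Type*} [TopologicalSpace B]
    {F : Type*} [NormedAddCommGroup F] [NormedSpace 𝕜 F]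
    {V : B → Type*} [∀ x, AddCommGroup (V x)] [∀ x, Module 𝕜 (V x)] [∀ x, TopologicalSpace (V x)]
    [TopologicalSpace (TotalSpace F V)] [FiberBundle F V] [VectorBundle 𝕜 F V]
    {x : B} (v : V x) : constExtend 𝕜 F v x = v := by
  have hx := FiberBundle.mem_baseSet_trivializationAt' (F := F) (E := V) x
  rw [constExtend, Trivialization.coe_symmₗ _ hx]
  exact (trivializationAt F V x).symm_apply_apply_mk hx v

theorem constExtend_eq_extend (𝕜 : Type*) [NontriviallyNormedField 𝕜] {B : Type*} [TopologicalSpace B]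
    {F : Type*} [NormedAddCommGroup F] [NormedSpace 𝕜 F]
    {V : B → Type*} [∀ x, AddCommGroup (V x)] [∀ x, Module 𝕜 (V x)] [∀ x, TopologicalSpace (V x)]
    [TopologicalSpace (TotalSpace F V)] [FiberBundle F V] [VectorBundle 𝕜 F V]
    {x y : B} (v : V x) (hy : y ∈ (trivializationAt F V x).baseSet) :
    constExtend 𝕜 F v y = FiberBundle.extend F v y := by
  rw [constExtend, Trivialization.coe_symmₗ _ hy]
  rfl

variable {n : ℕ} {M : Type*} [TopologicalSpace M]
  [ChartedSpace (EuclideanSpace ℝ (Fin (2 * n))) M] [IsManifold (𝓡 (2 * n)) ∞ M] [T2Space M]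
  {F : Type*} [NormedAddCommGroup F] [NormedSpace ℂ F]
  {S : M → Type*} [∀ x, AddCommGroup (S x)] [∀ x, Module ℂ (S x)]
  [∀ x, TopologicalSpace (S x)]
  [∀ x, IsTopologicalAddGroup (S x)] [∀ x, ContinuousSMul ℝ (S x)]
  [TopologicalSpace (TotalSpace F S)] [FiberBundle F S]
  [VectorBundle ℂ F S] [VectorBundle ℝ F S] [ContMDiffVectorBundle ∞ F S (𝓡 (2 * n))]

set_option linter.unusedSectionVars false

theorem exists_contMDiffOn_constExtend {x : M} (s : S x) :
    ∃ u ∈ 𝓝 x, ContMDiffOn (𝓡 (2 * n)) ((𝓡 (2 * n)).prod 𝓘(ℝ, F)) ∞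
      (fun y => TotalSpace.mk' F y (constExtend ℂ F s y)) u := by
  obtain ⟨u, hu, hs⟩ :=
    FiberBundle.exists_contMDiffOn_extend (k := ∞) (𝓡 (2 * n)) F s
  refine ⟨u ∩ (trivializationAt F S x).baseSet, Filter.inter_mem hu
    ((trivializationAt F S x).open_baseSet.mem_nhds
      (FiberBundle.mem_baseSet_trivializationAt' x)), ?_⟩
  refine (hs.mono Set.inter_subset_left).congr fun y hy => ?_
  rw [constExtend_eq_extend ℂ s hy.2]

theorem contMDiffAt_constExtend_tangent {x : M} (v : TangentSpace (𝓡 (2 * n)) x) :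
    ContMDiffAt (𝓡 (2 * n)) ((𝓡 (2 * n)).prod 𝓘(ℝ, EuclideanSpace ℝ (Fin (2 * n)))) ∞
      (fun y => TotalSpace.mk' (EuclideanSpace ℝ (Fin (2 * n))) y
        (constExtend ℝ (EuclideanSpace ℝ (Fin (2 * n))) v y)) x := by
  refine (FiberBundle.contMDiffAt_extend (k := ∞) (𝓡 (2 * n))
    (EuclideanSpace ℝ (Fin (2 * n))) v).congr_of_eventuallyEq ?_
  filter_upwards [(trivializationAt (EuclideanSpace ℝ (Fin (2 * n)))
    (TangentSpace (𝓡 (2 * n)) : M → Type _) x).open_baseSet.mem_nhds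
      (FiberBundle.mem_baseSet_trivializationAt' x)] with y hy
  rw [constExtend_eq_extend ℝ v hy]

theorem eventually_mdifferentiableAt_extend {x : M} (s : S x) :
    ∀ᶠ y in 𝓝 x, MDifferentiableAt (𝓡 (2 * n)) ((𝓡 (2 * n)).prod 𝓘(ℝ, F))
      (fun y => TotalSpace.mk' F y (constExtend ℂ F s y)) y := by
  obtain ⟨u, hu, hs⟩ := exists_contMDiffOn_constExtend (n := n) (F := F) s
  filter_upwards [eventually_mem_nhds_iff.2 hu] with y hy
  exact (hs.contMDiffAt hy).mdifferentiableAt (by simp)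

theorem mdifferentiableAt_connection_extend (D : ComplexConnection n M F S) {x : M}
    (v : TangentSpace (𝓡 (2 * n)) x) (s : S x) :
    MDifferentiableAt (𝓡 (2 * n)) ((𝓡 (2 * n)).prod 𝓘(ℝ, F)) (fun y => TotalSpace.mk' F y
      (D.toFun (constExtend ℂ F s) y
        (constExtend ℝ (EuclideanSpace ℝ (Fin (2 * n))) v y))) x := by
  obtain ⟨u, hu, hs⟩ := exists_contMDiffOn_constExtend (n := n) (F := F) s
  obtain ⟨o, hou, ho, hxo⟩ := mem_nhds_iff.1 hu
  obtain ⟨f, -, hf⟩ := (SmoothBumpFunction.nhds_basis_tsupport (I := 𝓡 (2 * n)) x).mem_iff.1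
    (ho.mem_nhds hxo)
  have h1 : ContMDiff (𝓡 (2 * n)) ((𝓡 (2 * n)).prod 𝓘(ℝ, F)) ∞
      (fun y => TotalSpace.mk' F y (((f : M → ℝ) • constExtend ℂ F s) y)) :=
    ContMDiffOn.smul_section_of_tsupport f.contMDiff.contMDiffOn ho hf (hs.mono hou)
  have h2 := D.smooth.contMDiff.contMDiff (σ := (f : M → ℝ) • constExtend ℂ F s)
    (h1.contMDiffOn)
  have h3 := (h2.contMDiffAt Filter.univ_mem (x := x)).clm_bundle_apply
    (contMDiffAt_constExtend_tangent v)
  refine (h3.mdifferentiableAt (by simp)).congr_of_eventuallyEq ?_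
  filter_upwards [ho.mem_nhds hxo, f.eventuallyEq_one.eventuallyEq_nhds] with y hy hy2
  have := D.isCovariantDerivativeOnUniv.congr_of_eventuallyEq (x := y)
    (σ := constExtend ℂ F s) (σ' := (f : M → ℝ) • constExtend ℂ F s)
    (((hs.mono hou).contMDiffAt (ho.mem_nhds hy)).mdifferentiableAt (by simp))
    ((h1 y).mdifferentiableAt (by simp)) Filter.univ_mem
    (by filter_upwards [hy2] with z hz; simp [hz])
  rw [this]

theorem connection_connection_extend_add (D : ComplexConnection n M F S) {x : M}
    (v : TangentSpace (𝓡 (2 * n)) x) (s t : S x) :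
    D.toFun (fun y => D.toFun (constExtend ℂ F (s + t)) y
        (constExtend ℝ (EuclideanSpace ℝ (Fin (2 * n))) v y)) x =
      D.toFun (fun y => D.toFun (constExtend ℂ F s) y
        (constExtend ℝ (EuclideanSpace ℝ (Fin (2 * n))) v y)) x +
      D.toFun (fun y => D.toFun (constExtend ℂ F t) y
        (constExtend ℝ (EuclideanSpace ℝ (Fin (2 * n))) v y)) x := by
  have hs := mdifferentiableAt_connection_extend D v s
  have ht := mdifferentiableAt_connection_extend D v t
  rw [← D.isCovariantDerivativeOnUniv.add hs ht]
  refine D.isCovariantDerivativeOnUniv.congr_of_eventuallyEq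
    (mdifferentiableAt_connection_extend D v (s + t)) (mdifferentiableAt_add_section hs ht)
    Filter.univ_mem ?_
  filter_upwards [eventually_mdifferentiableAt_extend (n := n) (F := F) s,
    eventually_mdifferentiableAt_extend (n := n) (F := F) t] with y h1 h2
  rw [constExtend_add, D.isCovariantDerivativeOnUniv.add h1 h2]
  rfl

theorem connection_connection_extend_smul (D : ComplexConnection n M F S) {x : M}
    (v w : TangentSpace (𝓡 (2 * n)) x) (c : ℂ) (s : S x) :
    D.toFun (fun y => D.toFun (constExtend ℂ F (c • s)) y
        (constExtend ℝ (EuclideanSpace ℝ (Fin (2 * n))) v y)) x w =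
      c • D.toFun (fun y => D.toFun (constExtend ℂ F s) y
        (constExtend ℝ (EuclideanSpace ℝ (Fin (2 * n))) v y)) x w := by
  have hs := mdifferentiableAt_connection_extend D v s
  have hcs := mdifferentiableAt_connection_extend D v (c • s)
  have key : ∀ᶠ y in 𝓝 x, D.toFun (constExtend ℂ F (c • s)) y
        (constExtend ℝ (EuclideanSpace ℝ (Fin (2 * n))) v y) =
      (c • (fun y => D.toFun (constExtend ℂ F s) y
        (constExtend ℝ (EuclideanSpace ℝ (Fin (2 * n))) v y)) : (y : M) → S y) y := by
    filter_upwards [eventually_mdifferentiableAt_extend (n := n) (F := F) s] with y h1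
    rw [constExtend_smul, D.complex_linear c _ y h1]
    rfl
  rw [← D.complex_linear c _ x hs]
  rw [D.isCovariantDerivativeOnUniv.congr_of_eventuallyEq hcs ?_ Filter.univ_mem key]
  refine hcs.congr_of_eventuallyEq ?_
  filter_upwards [key] with y hy
  rw [hy]

theorem curvatureAux_swap (D : ComplexConnection n M F S)
    (X Y : (x : M) → TangentSpace (𝓡 (2 * n)) x) (σ : (x : M) → S x) (x : M) :
    curvatureAux D X Y σ x = -curvatureAux D Y X σ x := by
  simp only [curvatureAux]
  rw [VectorField.mlieBracket_swap_apply, map_neg]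
  abel

theorem curvatureAux_add_left (D : ComplexConnection n M F S) {x : M}
    (v v' w : TangentSpace (𝓡 (2 * n)) x) (s : S x) :
    curvatureAux D (constExtend ℝ (EuclideanSpace ℝ (Fin (2 * n))) (v + v'))
      (constExtend ℝ (EuclideanSpace ℝ (Fin (2 * n))) w) (constExtend ℂ F s) x =
    curvatureAux D (constExtend ℝ (EuclideanSpace ℝ (Fin (2 * n))) v)
      (constExtend ℝ (EuclideanSpace ℝ (Fin (2 * n))) w) (constExtend ℂ F s) x +
    curvatureAux D (constExtend ℝ (EuclideanSpace ℝ (Fin (2 * n))) v')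
      (constExtend ℝ (EuclideanSpace ℝ (Fin (2 * n))) w) (constExtend ℂ F s) x := by
  have hv := fun v : TangentSpace (𝓡 (2 * n)) x =>
    (contMDiffAt_constExtend_tangent v).mdifferentiableAt (by simp)
  have h := D.isCovariantDerivativeOnUniv.add (mdifferentiableAt_connection_extend D v s)
    (mdifferentiableAt_connection_extend D v' s)
  simp only [curvatureAux]
  rw [constExtend_add, VectorField.mlieBracket_add_left (hv v) (hv v')]
  simp only [Pi.add_apply, map_add]
  erw [h]
  simp only [_root_.add_apply]
  abel

theorem curvatureAux_smul_left (D : ComplexConnection n M F S) {x : M} (c : ℝ)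
    (v w : TangentSpace (𝓡 (2 * n)) x) (s : S x) :
    curvatureAux D (constExtend ℝ (EuclideanSpace ℝ (Fin (2 * n))) (c • v))
      (constExtend ℝ (EuclideanSpace ℝ (Fin (2 * n))) w) (constExtend ℂ F s) x =
    c • curvatureAux D (constExtend ℝ (EuclideanSpace ℝ (Fin (2 * n))) v)
      (constExtend ℝ (EuclideanSpace ℝ (Fin (2 * n))) w) (constExtend ℂ F s) x := by
  have hv := (contMDiffAt_constExtend_tangent v).mdifferentiableAt (n := ∞) (by simp)
  have h := D.isCovariantDerivativeOnUniv.smul_const c (mdifferentiableAt_connection_extend D v s)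
  simp only [curvatureAux]
  rw [constExtend_smul, VectorField.mlieBracket_const_smul_left hv]
  simp only [Pi.smul_apply, map_smul]
  erw [h]
  simp only [_root_.smul_apply, smul_sub]

/-- The curvature `R ∈ Ω²(M) ⊗ Γ End(S)` of a connection at the point `x`: for `v, w ∈ T_x M` and
`s ∈ S_x` it is the value of `D_X D_Y σ - D_Y D_X σ - D_{[X, Y]} σ` at `x`, for local smooth
extensions `X`, `Y`, `σ` of `v`, `w`, `s`. (This expression is tensorial, so the extensions do not
matter; here they are constant in a local trivialization.) -/
def ComplexConnection.curvature (D : ComplexConnection n M F S) (x : M) :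
    TangentSpace (𝓡 (2 * n)) x →ₗ[ℝ] TangentSpace (𝓡 (2 * n)) x →ₗ[ℝ] Module.End ℂ (S x) :=
  LinearMap.mk₂ ℝ
    (fun v w =>
      { toFun := fun s => curvatureAux D (constExtend ℝ (EuclideanSpace ℝ (Fin (2 * n))) v)
          (constExtend ℝ (EuclideanSpace ℝ (Fin (2 * n))) w) (constExtend ℂ F s) x
        map_add' := fun s t => by
          simp only [curvatureAux, connection_connection_extend_add]
          rw [constExtend_add, D.isCovariantDerivativeOnUniv.add
            (eventually_mdifferentiableAt_extend s).self_of_nhds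
            (eventually_mdifferentiableAt_extend t).self_of_nhds]
          simp only [_root_.add_apply]
          abel
        map_smul' := fun c s => by
          simp only [curvatureAux, connection_connection_extend_smul]
          rw [constExtend_smul, D.complex_linear c _ x
            (eventually_mdifferentiableAt_extend s).self_of_nhds]
          simp only [smul_sub, RingHom.id_apply] })
    (fun v v' w => LinearMap.ext fun s => curvatureAux_add_left D v v' w s)
    (fun c v w => LinearMap.ext fun s => curvatureAux_smul_left D c v w s)
    (fun v w w' => LinearMap.ext fun s => by
      simp only [LinearMap.coe_mk, AddHom.coe_mk, LinearMap.add_apply]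
      rw [curvatureAux_swap, curvatureAux_add_left, curvatureAux_swap D _ _ _ x,
        curvatureAux_swap D (constExtend _ _ w') _ _ x]
      abel)
    (fun c v w => LinearMap.ext fun s => by
      simp only [LinearMap.coe_mk, AddHom.coe_mk, LinearMap.smul_apply]
      rw [curvatureAux_swap, curvatureAux_smul_left, curvatureAux_swap D _ _ _ x, smul_neg, neg_neg])

end Curvature

section SpinorBundleDefs

variable {n : ℕ} {M : Type*} [TopologicalSpace M]
  [ChartedSpace (EuclideanSpace ℝ (Fin (2 * n))) M] [IsManifold (𝓡 (2 * n)) ∞ M] [T2Space M]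
  [RiemannianBundle (fun x : M => TangentSpace (𝓡 (2 * n)) x)]
  {F : Type*} [NormedAddCommGroup F] [NormedSpace ℂ F]
  {S : M → Type*} [∀ x, AddCommGroup (S x)] [∀ x, Module ℂ (S x)]
  [∀ x, TopologicalSpace (S x)]
  [∀ x, IsTopologicalAddGroup (S x)] [∀ x, ContinuousSMul ℝ (S x)]
  [TopologicalSpace (TotalSpace F S)] [FiberBundle F S]
  [VectorBundle ℂ F S] [VectorBundle ℝ F S] [ContMDiffVectorBundle ∞ F S (𝓡 (2 * n))]

set_option linter.unusedSectionVars false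

theorem SpinorBundle.finiteDimensional_fiber (𝒮 : SpinorBundle n M F S) (x : M) :
    FiniteDimensional ℂ (S x) :=
  haveI : FiniteDimensional ℂ F :=
    Module.finite_of_finrank_pos (by rw [𝒮.rank_eq]; positivity)
  VectorBundle.finiteDimensional ℂ F S x

instance finiteDimensional_tangentSpace (x : M) :
    FiniteDimensional ℝ (TangentSpace (𝓡 (2 * n)) x) :=
  inferInstanceAs (FiniteDimensional ℝ (EuclideanSpace ℝ (Fin (2 * n))))

/-- The sign `w_η` of a spinor field at a point, with `γ^* η = w_η η` for chiral `η`. -/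
def SpinorBundle.sign (𝒮 : SpinorBundle n M F S) (hn : 2 ≤ n) (η : (x : M) → S x) (x : M) : ℂ :=
  chiralitySign (𝒮.chirality hn x) (η x)

/-- `𝔅(R; η, η)` at the point `x`, where `R` is the curvature of `D`. -/
def SpinorBundle.B (𝒮 : SpinorBundle n M F S) (D : ComplexConnection n M F S)
    (η : (x : M) → S x) (x : M) : S x →ₗ[ℂ] ExteriorAlgebra ℂ (S x) :=
  bracketB (𝒮.γ x) (D.curvature x) (η x) (η x)

/-- `γ^μ η ∧ γ^ν η ⊗ R_{μν}` at the point `x`, where `R` is the curvature of `D`. -/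
def SpinorBundle.BTensor (𝒮 : SpinorBundle n M F S) (D : ComplexConnection n M F S)
    (η : (x : M) → S x) (x : M) : ExteriorAlgebra ℂ (S x) ⊗[ℂ] Module.End ℂ (S x) :=
  bracketBTensor (𝒮.γ x) (D.curvature x) (η x) (η x)

/-- `ε^{a₁ … a_n} γ_{a₁ … a_{n-2}} (1 - (-1)^n w_η γ^*) · R_{a_{n-1} a_n}` at the point `x`, as a
vector field on the supermanifold. The unbarred indices refer to the basis `e` of the null space
of `η`: the complex structure defined by `η` is the one whose `(1, 0)`-vectors are the `X` with
`X η = 0`. -/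
def SpinorBundle.epsilonSum (𝒮 : SpinorBundle n M F S) (hn : 2 ≤ n)
    (D : ComplexConnection n M F S) (η : (x : M) → S x) (x : M)
    (e : Module.Basis (Fin n) ℂ (nullSpace (𝒮.γ x) (η x))) :
    S x →ₗ[ℂ] ExteriorAlgebra ℂ (S x) :=
  haveI := 𝒮.finiteDimensional_fiber x
  _root_.epsilonSum hn (𝒮.C x) (𝒮.C_nondegenerate x) (𝒮.γ x) (𝒮.chirality hn x) (𝒮.sign hn η x)
    (D.curvature x) (fun a => (e a : ℂ ⊗[ℝ] TangentSpace (𝓡 (2 * n)) x))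

/-- `ε^{a₁ … a_n} γ_{a₁ … a_{n-2}} (1 - (-1)^n w_η γ^*) ⊗ R_{a_{n-1} a_n}` at the point `x`, in
`End S ⊗ End S`. -/
def SpinorBundle.epsilonSumTensor (𝒮 : SpinorBundle n M F S) (hn : 2 ≤ n)
    (D : ComplexConnection n M F S) (η : (x : M) → S x) (x : M)
    (e : Module.Basis (Fin n) ℂ (nullSpace (𝒮.γ x) (η x))) :
    Module.End ℂ (S x) ⊗[ℂ] Module.End ℂ (S x) :=
  _root_.epsilonSumTensor hn (𝒮.γ x) (𝒮.chirality hn x) (𝒮.sign hn η x) (D.curvature x)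
    (fun a => (e a : ℂ ⊗[ℝ] TangentSpace (𝓡 (2 * n)) x))

end SpinorBundleDefs

end

/-!
The statement is pointwise linear algebra. Let `e₁, …, eₙ` be a basis of the null space of `η`. As
`η ≠ 0`, this null space is isotropic, so that the Clifford multiplications by the `eₐ`
anticommute; together with the multiplications by dual vectors `fₐ` of `V ⊗ ℂ` (normalized by
`eₐ fᵦ + fᵦ eₐ = δₐᵦ`, and not required to be isotropic) they satisfy the relations of annihilation
and creation operators. Each annihilation operator halves the dimension of the joint kernel
(`IsAnnihilation.finrank_eq`), so `dim W = 2 ^ n` makes the vacuum `η` unique up to a factor.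
The chirality operator anticommutes with all vectors and has square one, hence maps `η` to `± η`.

Put `θₐ = fₐ η`. A spinor `χ` of the chirality opposite to that of `η` with `eₐ χ = yₐ η` is equal
to `∑ yₐ θₐ` (`IsPureSpinorFrame.eq_sum`). This is used twice.

* It expands `γ^μ η` in the `θₐ`, which shows that the first expression is
  `4 ∑ θₐ ∧ θᵦ · Rₐᵦ` (`sum_orthonormalBasis_eq`).
* By uniqueness of the vacuum of the transposed operators, `e₁ ⋯ eₙ` is a nonzero multiple of
  `η ⊗ C(η, ·)` (`IsPureSpinorFrame.exists_prod_eq`). Consequently, if two of the factors,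
  `eₐ` and `eᵦ`, are left out, the product, restricted to the chirality selected by
  `1 - (-1)^n w γ^*`, is a nonzero multiple of `θₐ ⊗ C(θᵦ, ·) - θᵦ ⊗ C(θₐ, ·)`
  (`IsPureSpinorFrame.exists_prod_mul_eq_wedgeEnd`). Up to the sign of the permutation, the factor
  does not depend on `a` and `b`.

The endomorphism `θₐ ⊗ C(θᵦ, ·) - θᵦ ⊗ C(θₐ, ·)` corresponds to `2 θₐ ∧ θᵦ` in `Λ² W`. So on the
supermanifold the two expressions are nonzero multiples of each other. For the tensor product, the
linear maps `twoVectorₗ : End W → Λ W` and `wedgeToEnd : Λ W → End W` carry them to nonzero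
multiples of each other.
-/

/-! ### Products of anticommuting elements -/

section Products

theorem mul_prod_ofFn {A : Type*} [Ring A] {x : A} {m : ℕ} {g : Fin m → A} {ε : Fin m → ℤ}
    (h : ∀ i, x * g i = ε i • (g i * x)) :
    x * (List.ofFn g).prod = (∏ i, ε i) • ((List.ofFn g).prod * x) := by
  induction m with
  | zero => simp
  | succ m ih =>
    rw [List.ofFn_succ, List.prod_cons, Fin.prod_univ_succ, ← mul_assoc, h, smul_mul_assoc,
      mul_assoc, ih fun i => h i.succ, mul_smul_comm, smul_smul, mul_assoc]

theorem mul_prod_ofFn_of_anticomm {A : Type*} [Ring A] {x : A} {m : ℕ} {g : Fin m → A}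
    (h : ∀ i, x * g i = -(g i * x)) :
    x * (List.ofFn g).prod = ((-1) ^ m : ℤ) • ((List.ofFn g).prod * x) := by
  rw [mul_prod_ofFn (ε := fun _ => -1) (by simpa using h)]
  simp

theorem prod_ofFn_mul_of_anticomm {A : Type*} [Ring A] {x : A} {m : ℕ} {g : Fin m → A}
    (h : ∀ i, x * g i = -(g i * x)) :
    (List.ofFn g).prod * x = ((-1) ^ m : ℤ) • (x * (List.ofFn g).prod) := by
  rw [mul_prod_ofFn_of_anticomm h, smul_smul, ← mul_pow]
  simp

theorem mul_prod_ofFn_eq_zero {A : Type*} [Ring A] {m : ℕ} {g : Fin m → A}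
    (hsq : ∀ i, g i * g i = 0) (hg : ∀ i j, g i * g j = -(g j * g i)) (i : Fin m) :
    g i * (List.ofFn g).prod = 0 := by
  induction m with
  | zero => exact i.elim0
  | succ m ih =>
    rw [List.ofFn_succ, List.prod_cons, ← mul_assoc]
    refine Fin.cases ?_ (fun j => ?_) i
    · rw [hsq, zero_mul]
    · rw [hg, neg_mul, mul_assoc, ih (fun i => hsq i.succ) (fun i j => hg _ _), mul_zero, neg_zero]

theorem prod_ofFn_mul_self {A : Type*} [Ring A] {m : ℕ} {g : Fin m → A}
    (hsq : ∀ i, g i * g i = -1) (hg : ∀ i j, i ≠ j → g i * g j = -(g j * g i)) :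
    (List.ofFn g).prod * (List.ofFn g).prod = (((-1) ^ (m + 1).choose 2 : ℤ) : A) := by
  induction m with
  | zero => simp
  | succ m ih =>
    have h0 : ∀ i : Fin m, g 0 * g i.succ = -(g i.succ * g 0) :=
      fun i => hg _ _ (Fin.succ_ne_zero i).symm
    have h2 := ih (fun i => hsq i.succ) fun i j hij => hg _ _ fun h => hij (Fin.succ_injective _ h)
    rw [List.ofFn_succ, List.prod_cons]
    set Q := (List.ofFn fun i : Fin m => g i.succ).prod
    have h3 : Q * g 0 = ((-1) ^ m : ℤ) • (g 0 * Q) := prod_ofFn_mul_of_anticomm h0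
    calc g 0 * Q * (g 0 * Q) = g 0 * (Q * g 0) * Q := by simp only [mul_assoc]
      _ = ((-1) ^ m : ℤ) • ((g 0 * g 0) * (Q * Q)) := by
        rw [h3]
        simp only [mul_smul_comm, smul_mul_assoc, mul_assoc]
      _ = (((-1) ^ (m + 1 + 1).choose 2 : ℤ) : A) := by
        rw [hsq, h2, Nat.choose_succ_succ' (m + 1) 1, Nat.choose_one_right, zsmul_eq_mul,
          pow_add _ (m + 1), pow_succ]
        simp

/-- The span of mutually anticommuting elements consists of elements of square zero, so that their
products come from the exterior algebra, where `ιMulti` is alternating. -/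
theorem prod_ofFn_comp_perm {A : Type*} [Ring A] [Algebra ℂ A] {m : ℕ} {g : Fin m → A}
    (hg : ∀ i j, g i * g j + g j * g i = 0) (σ : Equiv.Perm (Fin m)) :
    (List.ofFn fun i => g (σ i)).prod =
      ((Equiv.Perm.sign σ : ℤ) : ℂ) • (List.ofFn g).prod := by
  have hL : ∀ x, Fintype.linearCombination ℂ g x * Fintype.linearCombination ℂ g x = 0 := by
    intro x
    have h : (2 : ℂ) • (Fintype.linearCombination ℂ g x * Fintype.linearCombination ℂ g x) = 0 := by
      rw [two_smul]
      simp only [Fintype.linearCombination_apply, Finset.sum_mul_sum, smul_mul_smul_comm]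
      conv_lhs => arg 2; rw [Finset.sum_comm]
      simp only [← Finset.sum_add_distrib]
      refine Finset.sum_eq_zero fun i _ => Finset.sum_eq_zero fun j _ => ?_
      rw [mul_comm (x j), ← smul_add, hg, smul_zero]
    exact (smul_eq_zero.1 h).resolve_left two_ne_zero
  have key := congrArg (ExteriorAlgebra.lift ℂ ⟨Fintype.linearCombination ℂ g, hL⟩)
    ((ExteriorAlgebra.ιMulti ℂ m).map_perm (fun i => (Pi.single i 1 : Fin m → ℂ)) σ)
  have hsgn : ∀ a : A, Equiv.Perm.sign σ • a = ((Equiv.Perm.sign σ : ℤ) : ℂ) • a := fun a => by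
    rw [Units.smul_def, Int.cast_smul_eq_zsmul]
  rw [Units.smul_def, map_zsmul] at key
  simpa [ExteriorAlgebra.ιMulti_apply, map_list_prod, List.map_ofFn, Function.comp_def,
    Fintype.linearCombination_apply_single, Int.cast_smul_eq_zsmul] using key

theorem prod_ofFn_eq_mul_last_two {A : Type*} [Monoid A] {n : ℕ} (hn : 2 ≤ n) (g : Fin n → A) :
    (List.ofFn g).prod =
      (List.ofFn fun i : Fin (n - 2) => g (Fin.castLE (Nat.sub_le n 2) i)).prod *
        g ⟨n - 2, by omega⟩ * g ⟨n - 1, by omega⟩ := by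
  obtain ⟨m, rfl⟩ := Nat.exists_eq_add_of_le' hn
  rw [List.ofFn_succ', List.ofFn_succ']
  simp only [List.concat_eq_append, List.prod_append, List.prod_singleton]
  rfl

/-- The sum over all permutations of a function of two fixed values is a multiple of the sum over
all pairs of distinct indices, since the symmetric group acts transitively on those pairs. -/
theorem sum_perm_apply_two {ι : Type*} [Fintype ι] [DecidableEq ι] {i j : ι} (hij : i ≠ j) :
    ∃ N : ℕ, N ≠ 0 ∧ ∀ {A : Type*} [AddCommMonoid A] (g : ι → ι → A), (∀ a, g a a = 0) →
      ∑ σ : Equiv.Perm ι, g (σ i) (σ j) = N • ∑ a, ∑ b, g a b := by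
  refine ⟨(Finset.univ.filter fun σ : Equiv.Perm ι => (σ i, σ j) = (i, j)).card, ?_, ?_⟩
  · exact Finset.card_ne_zero.2 ⟨1, by simp⟩
  · intro A _ g hg
    rw [← Fintype.sum_prod_type', Finset.smul_sum,
      ← Finset.sum_fiberwise_of_maps_to (t := Finset.univ) (g := fun σ : Equiv.Perm ι => (σ i, σ j))
        (fun _ _ => Finset.mem_univ _)]
    refine Finset.sum_congr rfl fun p _ => ?_
    obtain ⟨a, b⟩ := p
    by_cases hab : a = b
    · subst hab
      rw [hg, smul_zero]
      refine Finset.sum_eq_zero fun σ hσ => ?_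
      simp only [Finset.mem_filter, Finset.mem_univ, true_and, Prod.mk.injEq] at hσ
      rw [hσ.1, hσ.2, hg]
    · rw [Finset.sum_congr rfl (g := fun _ => g a b) fun σ hσ => by
          simp only [Finset.mem_filter, Finset.mem_univ, true_and, Prod.mk.injEq] at hσ
          rw [hσ.1, hσ.2], Finset.sum_const]
      congr 1
      obtain ⟨τ, hi, hj⟩ : ∃ τ : Equiv.Perm ι, τ i = a ∧ τ j = b := by
        refine ⟨Equiv.swap i a * Equiv.swap j (Equiv.swap i a b), ?_, ?_⟩
        · have hib : i ≠ Equiv.swap i a b := fun h => hab <| by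
            simpa using congrArg (Equiv.swap i a) h
          rw [Equiv.Perm.mul_apply, Equiv.swap_apply_of_ne_of_ne hij hib, Equiv.swap_apply_left]
        · rw [Equiv.Perm.mul_apply, Equiv.swap_apply_left]
          simp
      refine (Finset.card_bij (fun σ _ => τ * σ) ?_ ?_ ?_).symm
      · intro σ hσ
        simp only [Finset.mem_filter, Finset.mem_univ, true_and, Prod.mk.injEq] at hσ ⊢
        simp [hσ.1, hσ.2, hi, hj]
      · intro σ _ ρ _ h
        exact mul_left_cancel h
      · intro σ hσ
        simp only [Finset.mem_filter, Finset.mem_univ, true_and, Prod.mk.injEq] at hσ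
        refine ⟨τ⁻¹ * σ, ?_, by simp⟩
        simp [hσ.1, hσ.2, ← hi, ← hj]

end Products

/-! ### Annihilation operators and the vacuum -/

/-- The canonical anticommutation relations of annihilation operators `e` with operators `f` dual to
them. (The relations between the operators `f` are not needed.) -/
structure IsAnnihilation {W : Type*} [AddCommGroup W] [Module ℂ W] {ι : Type*} [DecidableEq ι]
    (e f : ι → Module.End ℂ W) : Prop where
  anticomm (i j : ι) : e i * e j + e j * e i = 0
  anticomm_dual (i j : ι) : e i * f j + f j * e i = if i = j then 1 else 0

namespace IsAnnihilation

variable {W : Type*} [AddCommGroup W] [Module ℂ W] {ι : Type*} [DecidableEq ι]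
  {e f : ι → Module.End ℂ W}

theorem apply_apply (h : IsAnnihilation e f) (i j : ι) (ψ : W) : e i (e j ψ) = -e j (e i ψ) :=
  eq_neg_of_add_eq_zero_left (by simpa using congr($(h.anticomm i j) ψ))

theorem apply_self (h : IsAnnihilation e f) (i : ι) (ψ : W) : e i (e i ψ) = 0 := by
  have h2 : (2 : ℂ) • e i (e i ψ) = 0 := by
    rw [two_smul]
    exact eq_neg_iff_add_eq_zero.1 (h.apply_apply i i ψ)
  exact (smul_eq_zero.1 h2).resolve_left two_ne_zero

theorem apply_dual (h : IsAnnihilation e f) (i j : ι) (ψ : W) :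
    e i (f j ψ) = (if i = j then ψ else 0) - f j (e i ψ) := by
  have := congr($(h.anticomm_dual i j) ψ)
  simp only [LinearMap.add_apply, Module.End.mul_apply] at this
  rw [eq_sub_iff_add_eq, this]
  split_ifs <;> simp

/-- Every annihilation operator halves the dimension: it maps the joint kernel of the previous ones
onto the new joint kernel, and its kernel there is the new joint kernel as well. -/
theorem finrank_eq [FiniteDimensional ℂ W] (h : IsAnnihilation e f) (s : Finset ι) :
    finrank ℂ W = 2 ^ s.card * finrank ℂ (⨅ i ∈ s, LinearMap.ker (e i) : Submodule ℂ W) := by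
  induction s using Finset.induction_on with
  | empty =>
    rw [show (⨅ i ∈ (∅ : Finset ι), LinearMap.ker (e i) : Submodule ℂ W) = ⊤ by simp, finrank_top]
    simp
  | insert a s ha ih =>
    rw [ih, Finset.card_insert_of_notMem ha, pow_succ, mul_assoc]
    congr 1
    set p : Submodule ℂ W := ⨅ i ∈ s, LinearMap.ker (e i) with hp
    set q : Submodule ℂ W := ⨅ i ∈ insert a s, LinearMap.ker (e i) with hq
    have mem_p : ∀ x, x ∈ p ↔ ∀ i ∈ s, e i x = 0 := fun x => by simp [hp, Submodule.mem_iInf]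
    have mem_q : ∀ x, x ∈ q ↔ e a x = 0 ∧ ∀ i ∈ s, e i x = 0 := fun x => by
      simp [hq, Submodule.mem_iInf]
    have hqp : q ≤ p := fun x hx => (mem_p x).2 ((mem_q x).1 hx).2
    rw [← LinearMap.finrank_range_add_finrank_ker ((e a).domRestrict p), two_mul]
    congr 1
    · suffices hr : LinearMap.range ((e a).domRestrict p) = q by rw [hr]
      ext x
      simp only [LinearMap.mem_range, LinearMap.domRestrict_apply, Subtype.exists, mem_q]
      constructor
      · rintro ⟨y, hy, rfl⟩
        refine ⟨h.apply_self a y, fun i hi => ?_⟩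
        rw [h.apply_apply, (mem_p y).1 hy i hi, map_zero, neg_zero]
      · rintro ⟨hx, hxs⟩
        refine ⟨f a x, (mem_p _).2 fun i hi => ?_, ?_⟩
        · rw [h.apply_dual, if_neg (ne_of_mem_of_not_mem hi ha), hxs i hi, map_zero, sub_zero]
        · rw [h.apply_dual, if_pos rfl, hx, map_zero, sub_zero]
    · rw [← (Submodule.comapSubtypeEquivOfLe hqp).finrank_eq]
      suffices hk : LinearMap.ker ((e a).domRestrict p) = q.comap p.subtype by rw [hk]
      ext x
      simp only [LinearMap.mem_ker, LinearMap.domRestrict_apply, Submodule.mem_comap, mem_q,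
        Submodule.subtype_apply]
      exact ⟨fun hx => ⟨hx, (mem_p _).1 x.2⟩, And.left⟩

/-- The vacuum is unique up to a factor if `W` has the dimension of the Fock space. -/
theorem exists_eq_smul [FiniteDimensional ℂ W] [Fintype ι] (h : IsAnnihilation e f)
    (hW : finrank ℂ W = 2 ^ Fintype.card ι) {η : W} (hη : η ≠ 0) (hη0 : ∀ i, e i η = 0) {ψ : W}
    (hψ : ∀ i, e i ψ = 0) : ∃ c : ℂ, ψ = c • η := by
  have h1 := h.finrank_eq Finset.univ
  rw [hW, Finset.card_univ] at h1
  have h2 : finrank ℂ (⨅ i ∈ Finset.univ, LinearMap.ker (e i) : Submodule ℂ W) = 1 :=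
    Nat.eq_of_mul_eq_mul_left (Nat.two_pow_pos (Fintype.card ι)) (by rw [← h1, mul_one])
  have hmem : ∀ x : W, (∀ i, e i x = 0) →
      x ∈ (⨅ i ∈ Finset.univ, LinearMap.ker (e i) : Submodule ℂ W) := fun x hx => by
    simpa [Submodule.mem_iInf] using hx
  obtain ⟨c, hc⟩ := (finrank_eq_one_iff_of_nonzero' ⟨η, hmem η hη0⟩
    (fun h => hη (congrArg Subtype.val h))).1 h2 ⟨ψ, hmem ψ hψ⟩
  exact ⟨c, (congrArg Subtype.val hc).symm⟩

theorem dualMap (h : IsAnnihilation e f) :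
    IsAnnihilation (W := Dual ℂ W) (fun i => (e i).dualMap) (fun i => (f i).dualMap) where
  anticomm i j := by
    ext φ ψ
    simpa [add_comm] using congr(φ ($(h.anticomm i j) ψ))
  anticomm_dual i j := by
    ext φ ψ
    have := congr(φ ($(h.anticomm_dual i j) ψ))
    split_ifs at this ⊢ <;> simpa [add_comm] using this

/-- A functional that annihilates the ranges of all annihilation operators is unique up to a
factor: it is a vacuum of the transposed operators. -/
theorem exists_eq_smul_dual [FiniteDimensional ℂ W] [Fintype ι] (h : IsAnnihilation e f)
    (hW : finrank ℂ W = 2 ^ Fintype.card ι) {μ : Dual ℂ W} (hμ : μ ≠ 0)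
    (hμ0 : ∀ i ψ, μ (e i ψ) = 0) {τ : Dual ℂ W} (hτ : ∀ i ψ, τ (e i ψ) = 0) :
    ∃ c : ℂ, τ = c • μ :=
  h.dualMap.exists_eq_smul (by rw [Subspace.dual_finrank_eq, hW]) hμ
    (fun i => LinearMap.ext (hμ0 i)) (fun i => LinearMap.ext (hτ i))

/-- A vacuum of several annihilation operators is in the range of their product: the creation
operators `f` give a preimage. -/
theorem exists_prod_apply_eq (h : IsAnnihilation e f) {l : List ι} (hl : l.Nodup) {x : W}
    (hx : ∀ i ∈ l, e i x = 0) : ∃ y, (l.map e).prod y = x := by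
  induction l generalizing x with
  | nil => exact ⟨x, rfl⟩
  | cons a l ih =>
    rw [List.nodup_cons] at hl
    obtain ⟨y, hy⟩ := ih hl.2 (x := f a x) fun i hi => by
      rw [h.apply_dual, if_neg (ne_of_mem_of_not_mem hi hl.1), hx i (List.mem_cons_of_mem _ hi),
        map_zero, sub_zero]
    refine ⟨y, ?_⟩
    rw [List.map_cons, List.prod_cons, Module.End.mul_apply, hy, h.apply_dual, if_pos rfl,
      hx a List.mem_cons_self, map_zero, sub_zero]

end IsAnnihilation

/-! ### Two-vectors and endomorphisms -/

section TwoVectors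

variable {W : Type*} [AddCommGroup W] [Module ℂ W]

/-- The endomorphism `φ ⊗ C(χ, ·) - χ ⊗ C(φ, ·)`, which corresponds to `φ ∧ χ` under `C`. -/
def wedgeEnd (C : LinearMap.BilinForm ℂ W) (φ χ : W) : Module.End ℂ W :=
  (C χ).smulRight φ - (C φ).smulRight χ

theorem wedgeEnd_apply (C : LinearMap.BilinForm ℂ W) (φ χ ψ : W) :
    wedgeEnd C φ χ ψ = C χ ψ • φ - C φ ψ • χ := rfl

theorem wedgeEnd_self (C : LinearMap.BilinForm ℂ W) (φ : W) : wedgeEnd C φ φ = 0 := sub_self _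

/-- The linear map `Λ W → End W` that sends `φ ∧ χ` to `φ ⊗ C(χ, ·) - χ ⊗ C(φ, ·)` and vanishes on
the forms of all degrees other than two. -/
def wedgeToEnd (C : LinearMap.BilinForm ℂ W) : ExteriorAlgebra ℂ W →ₗ[ℂ] Module.End ℂ W :=
  ExteriorAlgebra.liftAlternating (Function.update 0 2
    { toFun := fun v => wedgeEnd C (v 0) (v 1)
      map_update_add' := fun v i x y => by
        ext ψ
        fin_cases i <;> simp [wedgeEnd_apply, add_smul] <;> abel
      map_update_smul' := fun v i c x => by
        ext ψ
        fin_cases i <;> simp [wedgeEnd_apply, mul_smul, smul_sub, smul_comm c]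
      map_eq_zero_of_eq' := fun v i j hv hij => by
        have h01 : v 0 = v 1 := by fin_cases i <;> fin_cases j <;> simp_all
        rw [h01, wedgeEnd_self] })

theorem wedgeToEnd_ι_mul_ι (C : LinearMap.BilinForm ℂ W) (φ χ : W) :
    wedgeToEnd C (ExteriorAlgebra.ι ℂ φ * ExteriorAlgebra.ι ℂ χ) = wedgeEnd C φ χ := by
  have h : ExteriorAlgebra.ι ℂ φ * ExteriorAlgebra.ι ℂ χ =
      ExteriorAlgebra.ιMulti ℂ 2 ![φ, χ] := by
    simp [ExteriorAlgebra.ιMulti_apply]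
  rw [h, wedgeToEnd, ExteriorAlgebra.liftAlternating_apply_ιMulti, Function.update_self]
  rfl

variable [FiniteDimensional ℂ W] (C : LinearMap.BilinForm ℂ W) (hC : C.Nondegenerate)

/-- `twoVector` as a linear map. -/
noncomputable def twoVectorₗ : Module.End ℂ W →ₗ[ℂ] ExteriorAlgebra ℂ W where
  toFun := twoVector C hC
  map_add' Φ Ψ := by simp [twoVector, add_mul, Finset.sum_add_distrib]
  map_smul' c Φ := by simp [twoVector, Finset.smul_sum]

theorem twoVectorₗ_apply (Φ : Module.End ℂ W) : twoVectorₗ C hC Φ = twoVector C hC Φ := rfl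

theorem twoVector_smulRight (φ ψ : W) :
    twoVector C hC ((C ψ).smulRight φ) = ExteriorAlgebra.ι ℂ φ * ExteriorAlgebra.ι ℂ ψ := by
  conv_rhs => rw [← (C.dualBasis hC (Module.finBasis ℂ W)).sum_repr ψ]
  simp only [LinearMap.BilinForm.dualBasis_repr_apply, map_sum, map_smul, Finset.mul_sum]
  simp [twoVector]

theorem twoVector_wedgeEnd (φ χ : W) :
    twoVector C hC (wedgeEnd C φ χ) =
      (2 : ℂ) • (ExteriorAlgebra.ι ℂ φ * ExteriorAlgebra.ι ℂ χ) := by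
  have h : ExteriorAlgebra.ι ℂ χ * ExteriorAlgebra.ι ℂ φ =
      -(ExteriorAlgebra.ι ℂ φ * ExteriorAlgebra.ι ℂ χ) :=
    eq_neg_of_add_eq_zero_left (ExteriorAlgebra.ι_add_mul_swap χ φ)
  rw [wedgeEnd, ← twoVectorₗ_apply, map_sub, twoVectorₗ_apply, twoVectorₗ_apply,
    twoVector_smulRight, twoVector_smulRight, h, two_smul, sub_neg_eq_add]

end TwoVectors

/-! ### Spinors in a frame of the null space of a pure spinor -/

/-- The operators attached to a pure spinor `η`: the Clifford multiplications `e i` by a basis of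
its null space and `f i` by vectors dual to this basis, a chirality operator `gs` with `gs η = w η`,
and the charge conjugation `C` with the signs `Δ₀` and `Δ₁`. -/
structure IsPureSpinorFrame {W : Type*} [AddCommGroup W] [Module ℂ W] {n : ℕ}
    (e f : Fin n → Module.End ℂ W) (gs : Module.End ℂ W) (w : ℂ) (C : LinearMap.BilinForm ℂ W)
    (Δ₀ Δ₁ : ℤˣ) (η : W) : Prop extends IsAnnihilation e f where
  finrank_eq_two_pow : finrank ℂ W = 2 ^ n
  ne_zero : η ≠ 0
  annihilates (i : Fin n) : e i η = 0
  chirality_mul (i : Fin n) : gs * e i = -(e i * gs)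
  chirality_mul_dual (i : Fin n) : gs * f i = -(f i * gs)
  chirality_mul_self : gs * gs = 1
  chirality_apply : gs η = w • η
  sign_mul_self : w * w = 1
  nondegenerate : C.Nondegenerate
  symm (φ ψ : W) : C φ ψ = ((Δ₀ : ℤ) : ℂ) * C ψ φ
  symm_apply (i : Fin n) (φ ψ : W) : C φ (e i ψ) = ((Δ₁ : ℤ) : ℂ) * C ψ (e i φ)
  symm_dual_apply (i : Fin n) (φ ψ : W) : C φ (f i ψ) = ((Δ₁ : ℤ) : ℂ) * C ψ (f i φ)

namespace IsPureSpinorFrame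

variable {W : Type*} [AddCommGroup W] [Module ℂ W] {n : ℕ}
  {e f : Fin n → Module.End ℂ W} {gs : Module.End ℂ W} {w : ℂ} {C : LinearMap.BilinForm ℂ W}
  {Δ₀ Δ₁ : ℤˣ} {η : W}

theorem sign_ne_zero (h : IsPureSpinorFrame e f gs w C Δ₀ Δ₁ η) : w ≠ 0 := fun hw => by
  simpa [hw] using h.sign_mul_self

theorem smul_eq_zero_of_chirality (h : IsPureSpinorFrame e f gs w C Δ₀ Δ₁ η) {c : ℂ}
    (hc : gs (c • η) = -(w • c • η)) : c • η = 0 := by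
  rw [map_smul, h.chirality_apply, smul_comm, eq_neg_iff_add_eq_zero, ← two_smul ℂ, smul_smul] at hc
  exact (smul_eq_zero.1 hc).resolve_left (mul_ne_zero two_ne_zero h.sign_ne_zero)

theorem bilin_apply (h : IsPureSpinorFrame e f gs w C Δ₀ Δ₁ η) (i : Fin n) (ψ : W) :
    C η (e i ψ) = 0 := by
  rw [h.symm_apply, h.annihilates, map_zero, mul_zero]

theorem bilin_dual_apply (h : IsPureSpinorFrame e f gs w C Δ₀ Δ₁ η) (i : Fin n) (ψ : W) :
    C η (f i ψ) = ((Δ₁ : ℤ) : ℂ) * ((Δ₀ : ℤ) : ℂ) * C (f i η) ψ := by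
  rw [h.symm_dual_apply, h.symm, mul_assoc]

theorem apply_mul_eq_neg (h : IsPureSpinorFrame e f gs w C Δ₀ Δ₁ η) (i j : Fin n) :
    e i * e j = -(e j * e i) :=
  eq_neg_of_add_eq_zero_left (h.anticomm i j)

/-- If `E` completes `e a * e b` to the product of all annihilation operators, then `E * e a` is
computed by moving one creation operator `f b` through that product. -/
theorem apply_apply_eq (h : IsPureSpinorFrame e f gs w C Δ₀ Δ₁ η) {E : Module.End ℂ W} {c : ℂ}
    {a b : Fin n} (hab : a ≠ b) (hE : ∀ ψ, E (e a (e b ψ)) = (c * C η ψ) • η) {s : ℤ}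
    (hs : E * f b = s • (f b * E)) {ψ : W} (hψ : C η ψ = 0) :
    E (e a ψ) = (c * C η (f b ψ)) • η := by
  have h0 : E (f b (e a (e b ψ))) = 0 := by
    have := congr($hs (e a (e b ψ)))
    simpa [hE, hψ] using this
  rw [← hE, h.apply_dual b b, if_pos rfl, map_sub, map_sub, h.apply_dual a b, if_neg hab, zero_sub,
    map_neg, h0, neg_zero, sub_zero]

variable [FiniteDimensional ℂ W]

theorem exists_eq_smul (h : IsPureSpinorFrame e f gs w C Δ₀ Δ₁ η) {ψ : W}
    (hψ : ∀ i, e i ψ = 0) : ∃ c : ℂ, ψ = c • η :=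
  h.toIsAnnihilation.exists_eq_smul (by rw [h.finrank_eq_two_pow, Fintype.card_fin]) h.ne_zero
    h.annihilates hψ

/-- A spinor of the chirality opposite to that of `η` is determined by its images under the
annihilation operators, because there is no vacuum of that chirality. -/
theorem eq_sum (h : IsPureSpinorFrame e f gs w C Δ₀ Δ₁ η) {χ : W} (hχ : gs χ = -(w • χ))
    {y : Fin n → ℂ} (hy : ∀ i, e i χ = y i • η) : χ = ∑ i, y i • f i η := by
  rw [← sub_eq_zero]
  obtain ⟨c, hc⟩ := h.exists_eq_smul (ψ := χ - ∑ i, y i • f i η) fun i => by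
    simp [hy, h.apply_dual, h.annihilates]
  rw [hc]
  refine h.smul_eq_zero_of_chirality ?_
  have hf : ∀ i, gs (f i η) = -(w • f i η) := fun i => by
    simpa [h.chirality_apply] using congr($(h.chirality_mul_dual i) η)
  rw [← hc]
  simp only [map_sub, map_sum, map_smul, hχ, hf, smul_sub, Finset.smul_sum, smul_neg,
    Finset.sum_neg_distrib, smul_comm w]
  abel

/-- The product of all annihilation operators is a multiple of `η ⊗ C(η, ·)`: both are maps onto
the line of `η` which vanish on the ranges of the annihilation operators. -/
theorem exists_prod_eq (h : IsPureSpinorFrame e f gs w C Δ₀ Δ₁ η) :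
    ∃ c : ℂ, c ≠ 0 ∧ ∀ ψ, (List.ofFn e).prod ψ = (c * C η ψ) • η := by
  have hsq : ∀ i, e i * e i = 0 := fun i => LinearMap.ext (h.apply_self i)
  have hT : ∀ ψ, ∃ c : ℂ, (List.ofFn e).prod ψ = c • η := fun ψ => h.exists_eq_smul fun i => by
    simpa using congr($(mul_prod_ofFn_eq_zero hsq h.apply_mul_eq_neg i) ψ)
  have hTe : ∀ i ψ, (List.ofFn e).prod (e i ψ) = 0 := fun i ψ => by
    have := congr($(prod_ofFn_mul_of_anticomm (h.apply_mul_eq_neg i)) ψ)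
    rw [mul_prod_ofFn_eq_zero hsq h.apply_mul_eq_neg i, smul_zero] at this
    simpa using this
  -- a functional with value one on `η` turns the product into a functional
  obtain ⟨ν, hν⟩ : ∃ ν : Dual ℂ W, ν η = 1 := Module.Projective.exists_dual_eq_one ℂ h.ne_zero
  have hτ : ∀ ψ, (List.ofFn e).prod ψ = ν ((List.ofFn e).prod ψ) • η := fun ψ => by
    obtain ⟨c, hc⟩ := hT ψ
    rw [hc, map_smul, hν, smul_eq_mul, mul_one]
  have hCη : C η ≠ 0 := fun h0 => h.ne_zero (h.nondegenerate.1 η fun ψ => by rw [h0]; rfl)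
  obtain ⟨c, hc⟩ := h.exists_eq_smul_dual (by rw [h.finrank_eq_two_pow, Fintype.card_fin]) hCη
    h.bilin_apply (τ := ν ∘ₗ (List.ofFn e).prod) fun i ψ => by
      rw [LinearMap.comp_apply, hTe, map_zero]
  have hcψ : ∀ ψ, (List.ofFn e).prod ψ = (c * C η ψ) • η := fun ψ => by
    rw [hτ]
    congr 1
    exact congr($hc ψ)
  refine ⟨c, ?_, hcψ⟩
  rintro rfl
  obtain ⟨y, hy⟩ := h.exists_prod_apply_eq (List.nodup_finRange n) (x := η)
    fun i _ => h.annihilates i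
  rw [← List.ofFn_eq_map, hcψ, zero_mul, zero_smul] at hy
  exact h.ne_zero hy.symm

/-- `C(η, ·)` vanishes on one of the two chiralities. -/
theorem bilin_eq_zero_of_chirality (h : IsPureSpinorFrame e f gs w C Δ₀ Δ₁ η) {ψ : W}
    (hψ : gs ψ = -(((-1) ^ n * w) • ψ)) : C η ψ = 0 := by
  obtain ⟨c, hc0, hc⟩ := h.exists_prod_eq
  have hgs : gs ((List.ofFn e).prod ψ) = -(w • (List.ofFn e).prod ψ) := by
    have := congr($(mul_prod_ofFn_of_anticomm h.chirality_mul) ψ)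
    simp only [Module.End.mul_apply, LinearMap.smul_apply, hψ, map_neg, map_smul] at this
    rw [this, smul_neg, ← Int.cast_smul_eq_zsmul ℂ, smul_smul, ← mul_assoc]
    push_cast
    rw [← mul_pow]
    simp
  rw [hc] at hgs
  have h0 := (smul_eq_zero.1 (h.smul_eq_zero_of_chirality hgs)).resolve_right h.ne_zero
  exact (mul_eq_zero.1 h0).resolve_left hc0

/-- The crucial identity: skew-symmetrizing in all but two of the null vectors and projecting to
one chirality leaves the two-vector formed by the remaining two indices. -/
theorem exists_prod_mul_eq_wedgeEnd (h : IsPureSpinorFrame e f gs w C Δ₀ Δ₁ η) (hn : 2 ≤ n) :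
    ∃ k : ℂ, k ≠ 0 ∧ ∀ σ : Equiv.Perm (Fin n),
      (List.ofFn fun i : Fin (n - 2) => e (σ (Fin.castLE (Nat.sub_le n 2) i))).prod *
          (1 - ((-1 : ℂ) ^ n * w) • gs) =
        (((Equiv.Perm.sign σ : ℤ) : ℂ) * k) •
          wedgeEnd C (f (σ ⟨n - 2, by omega⟩) η) (f (σ ⟨n - 1, by omega⟩) η) := by
  obtain ⟨c, hc0, hc⟩ := h.exists_prod_eq
  have hpow : ((-1 : ℤ) ^ (n - 2)) = (-1) ^ n := by
    obtain ⟨m, rfl⟩ := Nat.exists_eq_add_of_le' hn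
    simp [pow_add]
  have hu : ((-1 : ℂ) ^ n * w) * ((-1 : ℂ) ^ n * w) = 1 := by
    rw [mul_mul_mul_comm, ← mul_pow, h.sign_mul_self]
    simp
  refine ⟨(-1) ^ n * c * (2 * (((Δ₁ : ℤ) : ℂ) * ((Δ₀ : ℤ) : ℂ))), ?_, fun σ => ?_⟩
  · have hΔ : ∀ Δ : ℤˣ, ((Δ : ℤ) : ℂ) ≠ 0 := fun Δ => Int.cast_ne_zero.2 Δ.ne_zero
    exact mul_ne_zero (mul_ne_zero (pow_ne_zero _ (by norm_num)) hc0)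
      (mul_ne_zero two_ne_zero (mul_ne_zero (hΔ _) (hΔ _)))
  set E := (List.ofFn fun i : Fin (n - 2) => e (σ (Fin.castLE (Nat.sub_le n 2) i))).prod with hE
  set a := σ ⟨n - 2, by omega⟩ with ha
  set b := σ ⟨n - 1, by omega⟩ with hb
  set t : ℂ := ((Equiv.Perm.sign σ : ℤ) : ℂ) with ht
  have hab : a ≠ b := fun hab => by
    have := congrArg Fin.val (σ.injective hab)
    simp only at this
    omega
  have hEab : ∀ ψ, E (e a (e b ψ)) = (t * c * C η ψ) • η := fun ψ => by
    have h1 := congr($(prod_ofFn_eq_mul_last_two hn fun i => e (σ i)) ψ)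
    rw [prod_ofFn_comp_perm h.anticomm, LinearMap.smul_apply, hc, smul_smul, ← mul_assoc] at h1
    exact h1.symm
  have hEba : ∀ ψ, E (e b (e a ψ)) = (-(t * c) * C η ψ) • η := fun ψ => by
    rw [h.apply_apply, map_neg, hEab, neg_mul, neg_smul]
  have hinj : ∀ (j : Fin n) (hj : (j : ℕ) = n - 2 ∨ (j : ℕ) = n - 1) (i : Fin (n - 2)),
      σ (Fin.castLE (Nat.sub_le n 2) i) ≠ σ j := fun j hj i hij => by
    have := congrArg Fin.val (σ.injective hij)
    simp only [Fin.val_castLE] at this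
    omega
  have hfE : ∀ (j : Fin n) (_ : (j : ℕ) = n - 2 ∨ (j : ℕ) = n - 1),
      E * f (σ j) = ((-1) ^ (n - 2) : ℤ) • (f (σ j) * E) := fun j hj =>
    prod_ofFn_mul_of_anticomm fun i => by
      have := h.anticomm_dual (σ (Fin.castLE (Nat.sub_le n 2) i)) (σ j)
      rw [if_neg (hinj j hj i)] at this
      exact eq_neg_of_add_eq_zero_right this
  have heE : ∀ j ψ, e j (E ψ) = ((-1 : ℂ) ^ n) • E (e j ψ) := fun j ψ => by
    have := congr($(mul_prod_ofFn_of_anticomm (x := e j)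
      fun i : Fin (n - 2) => h.apply_mul_eq_neg j (σ (Fin.castLE (Nat.sub_le n 2) i))) ψ)
    rw [hpow, LinearMap.smul_apply, ← Int.cast_smul_eq_zsmul ℂ] at this
    simpa using this
  have hgE : ∀ ψ, gs (E ψ) = ((-1 : ℂ) ^ n) • E (gs ψ) := fun ψ => by
    have := congr($(mul_prod_ofFn_of_anticomm (x := gs)
      fun i : Fin (n - 2) => h.chirality_mul (σ (Fin.castLE (Nat.sub_le n 2) i))) ψ)
    rw [hpow, LinearMap.smul_apply, ← Int.cast_smul_eq_zsmul ℂ] at this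
    simpa using this
  have hE0 : ∀ j, j ≠ a → j ≠ b → ∀ ψ, e j (E ψ) = 0 := fun j hja hjb ψ => by
    have hj1 : ((σ.symm j : Fin n) : ℕ) ≠ n - 2 := fun hj =>
      hja (by rw [ha, ← σ.apply_symm_apply j]; congr 1; exact Fin.ext hj)
    have hj2 : ((σ.symm j : Fin n) : ℕ) ≠ n - 1 := fun hj =>
      hjb (by rw [hb, ← σ.apply_symm_apply j]; congr 1; exact Fin.ext hj)
    have := congr($(mul_prod_ofFn_eq_zero
      (g := fun i : Fin (n - 2) => e (σ (Fin.castLE (Nat.sub_le n 2) i)))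
      (fun i => LinearMap.ext (h.apply_self _)) (fun i j => h.apply_mul_eq_neg _ _)
      ⟨σ.symm j, by have := (σ.symm j).isLt; omega⟩) ψ)
    simpa using this
  refine LinearMap.ext fun ψ => ?_
  set u : ℂ := (-1 : ℂ) ^ n * w with hu_def
  rw [Module.End.mul_apply, LinearMap.sub_apply, Module.End.one_apply, LinearMap.smul_apply]
  have hgg : ∀ ψ, gs (gs ψ) = ψ := fun ψ => congr($(h.chirality_mul_self) ψ)
  have hgf : ∀ j ψ, gs (f j ψ) = -f j (gs ψ) := fun j ψ => congr($(h.chirality_mul_dual j) ψ)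
  set ψ' := ψ - u • gs ψ with hψ'
  have hgψ' : gs ψ' = -(u • ψ') := by
    rw [hψ', map_sub, map_smul, hgg, smul_sub, smul_smul, hu, one_smul]
    abel
  have hC' : C η ψ' = 0 := h.bilin_eq_zero_of_chirality hgψ'
  have hCf : ∀ j, C η (f j ψ') = 2 * (((Δ₁ : ℤ) : ℂ) * ((Δ₀ : ℤ) : ℂ)) * C (f j η) ψ := fun j => by
    -- the part of `ψ` of the other chirality does not contribute
    have h2 : C η (f j (ψ + u • gs ψ)) = 0 := by
      refine h.bilin_eq_zero_of_chirality ?_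
      rw [hgf, map_add, map_smul, hgg, ← hu_def, ← map_smul, smul_add, smul_smul, hu, one_smul,
        add_comm]
    have h3 : ψ' = (2 : ℂ) • ψ - (ψ + u • gs ψ) := by
      rw [hψ', two_smul]
      abel
    rw [h3, map_sub, map_sub, h2, sub_zero, map_smul, map_smul, h.bilin_dual_apply, smul_eq_mul]
    ring
  have hχ : gs (E ψ') = -(w • E ψ') := by
    rw [hgE, hgψ', map_neg, map_smul, smul_neg, smul_smul, hu_def, ← mul_assoc, ← mul_pow]
    simp
  rw [h.eq_sum hχ (y := fun j => if j = a then (-1) ^ n * (t * c * C η (f b ψ')) else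
    if j = b then (-1) ^ n * (-(t * c) * C η (f a ψ')) else 0) fun j => ?_]
  · rw [Fintype.sum_eq_add a b hab fun j hj => by simp [hj.1, hj.2]]
    simp only [if_true, if_neg hab.symm, hCf, LinearMap.smul_apply, wedgeEnd_apply]
    module
  · split_ifs with hja hjb
    · rw [hja, heE, h.apply_apply_eq hab hEab (hfE _ (Or.inr rfl)) hC', smul_smul]
    · rw [hjb, heE, h.apply_apply_eq hab.symm hEba (hfE _ (Or.inl rfl)) hC', smul_smul]
    · rw [hE0 j hja hjb, zero_smul]

end IsPureSpinorFrame

/-! ### The complexified Clifford multiplication -/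

section Clifford

variable {V : Type*} [NormedAddCommGroup V] [InnerProductSpace ℝ V]
  {W : Type*} [AddCommGroup W] [Module ℂ W] {γ : V →ₗ[ℝ] Module.End ℂ W}
  {ι : Type*} [Fintype ι]

theorem cliffordC_tmul (γ : V →ₗ[ℝ] Module.End ℂ W) (c : ℂ) (v : V) :
    cliffordC γ (c ⊗ₜ v) = c • γ v := by
  simp [cliffordC]

theorem curvC_one_tmul (R : V →ₗ[ℝ] V →ₗ[ℝ] Module.End ℂ W) (v v' : V) :
    curvC R (1 ⊗ₜ v) (1 ⊗ₜ v') = R v v' := by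
  simp [curvC]

/-- An orthonormal basis of `V`, as a basis of the complexification. -/
noncomputable def complexBasis (b : OrthonormalBasis ι ℝ V) : Module.Basis ι ℂ (ℂ ⊗[ℝ] V) :=
  b.toBasis.baseChange ℂ

theorem complexBasis_apply (b : OrthonormalBasis ι ℝ V) (i : ι) :
    complexBasis b i = 1 ⊗ₜ b i := by
  simp [complexBasis]

theorem complexBasis_repr_tmul (b : OrthonormalBasis ι ℝ V) (c : ℂ) (v : V) (i : ι) :
    (complexBasis b).repr (c ⊗ₜ v) i = (inner ℝ v (b i) : ℝ) * c := by
  simp [complexBasis, Module.Basis.baseChange_repr_tmul, b.repr_apply_apply, real_inner_comm]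

variable (hγ : ∀ X Y : V,
  γ X * γ Y + γ Y * γ X = ((-2 * inner ℝ X Y : ℝ) : ℂ) • (1 : Module.End ℂ W))
include hγ

theorem cliffordC_mul_add_mul (b : OrthonormalBasis ι ℝ V) (x : ℂ ⊗[ℝ] V) (i : ι) :
    cliffordC γ x * γ (b i) + γ (b i) * cliffordC γ x =
      (-2 * (complexBasis b).repr x i) • (1 : Module.End ℂ W) := by
  induction x using TensorProduct.induction_on with
  | zero => simp
  | tmul c v =>
    rw [cliffordC_tmul, complexBasis_repr_tmul, smul_mul_assoc, mul_smul_comm, ← smul_add, hγ,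
      smul_smul]
    congr 1
    push_cast
    ring
  | add x y hx hy =>
    rw [map_add, add_mul, mul_add, add_add_add_comm, hx, hy, map_add, Finsupp.add_apply, mul_add,
      add_smul]

theorem cliffordC_mul_add_mul_sum (b : OrthonormalBasis ι ℝ V) (x : ℂ ⊗[ℝ] V) (c : ι → ℂ) :
    cliffordC γ x * cliffordC γ (∑ i, c i • (1 ⊗ₜ b i)) +
      cliffordC γ (∑ i, c i • (1 ⊗ₜ b i)) * cliffordC γ x =
      (-2 * ∑ i, c i * (complexBasis b).repr x i) • (1 : Module.End ℂ W) := by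
  simp only [map_sum, map_smul, cliffordC_tmul, one_smul, Finset.mul_sum, Finset.sum_mul,
    mul_smul_comm, smul_mul_assoc, ← Finset.sum_add_distrib, ← smul_add,
    cliffordC_mul_add_mul hγ, smul_smul, ← Finset.sum_smul]
  congr 1
  exact Finset.sum_congr rfl fun i _ => by ring

/-- The null space of a nonzero spinor is isotropic. -/
theorem cliffordC_anticomm_of_mem_nullSpace (b : OrthonormalBasis ι ℝ V) {η : W} (hη : η ≠ 0)
    {x y : ℂ ⊗[ℝ] V} (hx : x ∈ nullSpace γ η) (hy : y ∈ nullSpace γ η) :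
    cliffordC γ x * cliffordC γ y + cliffordC γ y * cliffordC γ x = 0 := by
  have hx0 : cliffordC γ x η = 0 := hx
  have hy0 : cliffordC γ y η = 0 := hy
  have key := cliffordC_mul_add_mul_sum hγ b x ((complexBasis b).repr y)
  simp only [← complexBasis_apply, Module.Basis.sum_repr] at key
  have h0 := congr($key η)
  simp only [LinearMap.add_apply, Module.End.mul_apply, hx0, hy0, map_zero, add_zero,
    LinearMap.smul_apply, Module.End.one_apply] at h0
  rw [key, (smul_eq_zero.1 h0.symm).resolve_right hη, zero_smul]

/-- Vectors dual to a basis of a subspace of the complexification. They represent functionals that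
extend the coordinates of this subspace. -/
theorem exists_dual_vectors (b : OrthonormalBasis ι ℝ V) {κ : Type*} [DecidableEq κ]
    {N : Submodule ℂ (ℂ ⊗[ℝ] V)} (e : Module.Basis κ ℂ N) :
    ∃ f : κ → ℂ ⊗[ℝ] V, ∀ i j,
      cliffordC γ (e i) * cliffordC γ (f j) + cliffordC γ (f j) * cliffordC γ (e i) =
        if i = j then 1 else 0 := by
  choose φ hφ using fun j => (e.coord j).exists_extend
  refine ⟨fun j => ∑ i, (-2⁻¹ * φ j (1 ⊗ₜ b i)) • (1 ⊗ₜ b i), fun i j => ?_⟩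
  rw [cliffordC_mul_add_mul_sum hγ]
  have h1 : φ j (e i) = if i = j then 1 else 0 := by
    have := congr($(hφ j) (e i))
    simpa [Finsupp.single_apply] using this
  have h2 : φ j (e i) = ∑ k, (complexBasis b).repr (e i) k * φ j (1 ⊗ₜ b k) := by
    conv_lhs => rw [← (complexBasis b).sum_repr (e i)]
    simp only [map_sum, map_smul, smul_eq_mul, complexBasis_apply]
  have h3 : -2 * ∑ k, -2⁻¹ * φ j (1 ⊗ₜ b k) * (complexBasis b).repr (e i) k = φ j (e i) := by
    rw [h2, Finset.mul_sum]
    exact Finset.sum_congr rfl fun k _ => by ring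
  rw [h3, h1]
  split_ifs <;> simp

theorem clifford_orthonormal_anticomm (b : OrthonormalBasis ι ℝ V) {i j : ι} (hij : i ≠ j) :
    γ (b i) * γ (b j) = -(γ (b j) * γ (b i)) :=
  eq_neg_of_add_eq_zero_left (by rw [hγ, b.inner_eq_zero hij]; simp)

theorem clifford_orthonormal_mul_self (b : OrthonormalBasis ι ℝ V) (i : ι) :
    γ (b i) * γ (b i) = -1 := by
  have h := hγ (b i) (b i)
  rw [real_inner_self_eq_norm_sq, b.norm_eq_one, ← two_smul ℂ] at h
  have h2 : (2 : ℂ) • (γ (b i) * γ (b i)) = (2 : ℂ) • (-1 : Module.End ℂ W) := by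
    rw [h]
    push_cast
    module
  exact (smul_right_injective _ (two_ne_zero' ℂ)) h2

theorem chiralityOp_mul_self {n : ℕ} (b : OrthonormalBasis (Fin (2 * n)) ℝ V) :
    chiralityOp γ b * chiralityOp γ b = 1 := by
  have hP := prod_ofFn_mul_self (clifford_orthonormal_mul_self hγ b)
    fun i j hij => clifford_orthonormal_anticomm hγ b hij
  have hc : (2 * n + 1).choose 2 = n * (2 * n + 1) := by
    rw [Nat.choose_two_right, Nat.add_sub_cancel, mul_comm, mul_assoc,
      Nat.mul_div_cancel_left _ two_pos]
  rw [chiralityOp, smul_mul_smul_comm, hP, hc]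
  split_ifs with hn
  · simp [(hn.mul_right _).neg_one_pow]
  · have hodd : Odd (n * (2 * n + 1)) := (Nat.not_even_iff_odd.1 hn).mul (odd_two_mul_add_one n)
    simp [hodd.neg_one_pow]

/-- A vector of the orthonormal basis commutes with one factor of the chirality operator and
anticommutes with the other `2 n - 1` factors. -/
theorem chiralityOp_mul_cliffordC {n : ℕ} (b : OrthonormalBasis (Fin (2 * n)) ℝ V)
    (x : ℂ ⊗[ℝ] V) : chiralityOp γ b * cliffordC γ x = -(cliffordC γ x * chiralityOp γ b) := by
  have hb : ∀ j, chiralityOp γ b * γ (b j) = -(γ (b j) * chiralityOp γ b) := fun j => by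
    have h := mul_prod_ofFn (x := γ (b j)) (g := fun i => γ (b i))
      (ε := fun i => (-1) * if i = j then -1 else 1) fun i => by
        split_ifs with hij
        · subst hij
          simp
        · simp [clifford_orthonormal_anticomm hγ b (Ne.symm hij)]
    rw [Finset.prod_mul_distrib, Finset.prod_const, Finset.card_univ, Fintype.card_fin, pow_mul,
      Finset.prod_ite_eq' Finset.univ j] at h
    simp only [neg_one_sq, one_pow, Finset.mem_univ, if_true, one_mul, neg_smul, one_smul] at h
    rw [chiralityOp, smul_mul_assoc, mul_smul_comm, h, smul_neg, neg_neg]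
  rw [← (complexBasis b).sum_repr x]
  simp only [map_sum, map_smul, complexBasis_apply, cliffordC_tmul, one_smul, Finset.mul_sum,
    Finset.sum_mul, mul_smul_comm, smul_mul_assoc, hb, smul_neg, Finset.sum_neg_distrib]

end Clifford

section NullFrame

variable {V : Type*} [NormedAddCommGroup V] [InnerProductSpace ℝ V]
  {W : Type*} [AddCommGroup W] [Module ℂ W] {γ : V →ₗ[ℝ] Module.End ℂ W}

theorem gammaSkew_eq_prod {k : ℕ} {v : Fin k → ℂ ⊗[ℝ] V}
    (hv : ∀ i j, cliffordC γ (v i) * cliffordC γ (v j) + cliffordC γ (v j) * cliffordC γ (v i) = 0) :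
    gammaSkew γ v = (List.ofFn fun i => cliffordC γ (v i)).prod := by
  have hs : ∀ σ : Equiv.Perm (Fin k), ((Equiv.Perm.sign σ : ℤ) : ℂ) *
      ((Equiv.Perm.sign σ : ℤ) : ℂ) = 1 := fun σ => by
    rw [← Int.cast_mul, ← Units.val_mul, Int.units_mul_self, Units.val_one, Int.cast_one]
  simp only [gammaSkew, prod_ofFn_comp_perm (g := fun i => cliffordC γ (v i)) hv, smul_smul, hs,
    one_smul, Finset.sum_const, Finset.card_univ, Fintype.card_perm, Fintype.card_fin]
  rw [← Nat.cast_smul_eq_nsmul ℂ, smul_smul,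
    inv_mul_cancel₀ (Nat.cast_ne_zero.2 k.factorial_ne_zero), one_smul]

theorem IsPureSpinor.ne_zero {n : ℕ} (hn : n ≠ 0) (b : OrthonormalBasis (Fin (2 * n)) ℝ V) {η : W}
    (hη : IsPureSpinor n γ η) : η ≠ 0 := by
  rintro rfl
  have h : nullSpace γ (0 : W) = ⊤ := by
    ext x
    simp [nullSpace]
  rw [IsPureSpinor, h, finrank_top, Module.finrank_eq_card_basis (complexBasis b),
    Fintype.card_fin] at hη
  omega

/-- A basis of the null space of a pure spinor and dual vectors form an `IsPureSpinorFrame`. In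
particular, the pure spinor is an eigenvector of the chirality operator, as the unique vacuum. -/
theorem exists_isPureSpinorFrame [FiniteDimensional ℂ W] {n : ℕ} (hn : n ≠ 0)
    (hγ : ∀ X Y : V, γ X * γ Y + γ Y * γ X =
      ((-2 * inner ℝ X Y : ℝ) : ℂ) • (1 : Module.End ℂ W))
    (hW : finrank ℂ W = 2 ^ n) {C : LinearMap.BilinForm ℂ W} (hC : C.Nondegenerate) {Δ₀ Δ₁ : ℤˣ}
    (hC₀ : ∀ φ ψ, C φ ψ = ((Δ₀ : ℤ) : ℂ) * C ψ φ)
    (hC₁ : ∀ X φ ψ, C φ (γ X ψ) = ((Δ₁ : ℤ) : ℂ) * C ψ (γ X φ))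
    (b : OrthonormalBasis (Fin (2 * n)) ℝ V) {η : W} (hη : IsPureSpinor n γ η)
    (e : Module.Basis (Fin n) ℂ (nullSpace γ η)) :
    ∃ f : Fin n → ℂ ⊗[ℝ] V, IsPureSpinorFrame (fun i => cliffordC γ (e i))
      (fun i => cliffordC γ (f i)) (chiralityOp γ b) (chiralitySign (chiralityOp γ b) η) C
      Δ₀ Δ₁ η := by
  have hη0 := hη.ne_zero hn b
  obtain ⟨f, hf⟩ := exists_dual_vectors hγ b e
  have hann : IsAnnihilation (fun i => cliffordC γ (e i)) (fun i => cliffordC γ (f i)) :=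
    ⟨fun i j => cliffordC_anticomm_of_mem_nullSpace hγ b hη0 (e i).2 (e j).2, hf⟩
  have he : ∀ i, cliffordC γ (e i) η = 0 := fun i => (e i).2
  have hgs := chiralityOp_mul_cliffordC hγ b
  have hsq := chiralityOp_mul_self hγ b
  have hCx : ∀ (x : ℂ ⊗[ℝ] V) (φ ψ : W),
      C φ (cliffordC γ x ψ) = ((Δ₁ : ℤ) : ℂ) * C ψ (cliffordC γ x φ) := fun x φ ψ => by
    induction x using TensorProduct.induction_on with
    | zero => simp
    | tmul c v => simp only [cliffordC_tmul, LinearMap.smul_apply, map_smul, hC₁ v φ ψ,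
        smul_eq_mul, mul_left_comm]
    | add x y hx hy => simp only [map_add, LinearMap.add_apply, hx, hy, mul_add]
  obtain ⟨c, hc⟩ := hann.exists_eq_smul (by rw [hW, Fintype.card_fin]) hη0 he
    (ψ := chiralityOp γ b η) fun i => by
      have := congr($(hgs (e i)) η)
      simpa [he] using this.symm
  have hcc : c * c = 1 := by
    have := congr($hsq η)
    rw [Module.End.mul_apply, hc, map_smul, hc, smul_smul, Module.End.one_apply] at this
    exact smul_left_injective ℂ hη0 (by simpa using this)
  have hw : chiralitySign (chiralityOp γ b) η = c := by
    rw [chiralitySign]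
    rcases mul_self_eq_one_iff.1 hcc with rfl | rfl
    · rw [if_pos (by simpa using hc)]
    · refine if_neg fun h => hη0 ?_
      rw [hc, neg_one_smul] at h
      have h2 : (2 : ℂ) • η = 0 := by
        rw [two_smul]
        nth_rw 1 [← h]
        exact neg_add_cancel η
      exact (smul_eq_zero.1 h2).resolve_left two_ne_zero
  exact ⟨f, { hann with
    finrank_eq_two_pow := hW
    ne_zero := hη0
    annihilates := he
    chirality_mul := fun i => hgs _
    chirality_mul_dual := fun i => hgs _
    chirality_mul_self := hsq
    chirality_apply := by rw [hw, hc]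
    sign_mul_self := by rw [hw, hcc]
    nondegenerate := hC
    symm := hC₀
    symm_apply := fun i => hCx _
    symm_dual_apply := fun i => hCx _ }⟩

end NullFrame

/-! ### The two expressions in a frame of the null space -/

section Brackets

variable {V : Type*} [NormedAddCommGroup V] [InnerProductSpace ℝ V]
  {W : Type*} [AddCommGroup W] [Module ℂ W] {γ : V →ₗ[ℝ] Module.End ℂ W}

/-- `owedge` as a bilinear map. -/
noncomputable def owedgeₗ (W : Type*) [AddCommGroup W] [Module ℂ W] :
    ExteriorAlgebra ℂ W →ₗ[ℂ] Module.End ℂ W →ₗ[ℂ] W →ₗ[ℂ] ExteriorAlgebra ℂ W :=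
  LinearMap.mk₂ ℂ owedge
    (fun α β Φ => by ext ψ; simp [owedge, add_mul])
    (fun c α Φ => by ext ψ; simp [owedge])
    (fun α Φ Ψ => by ext ψ; simp [owedge, mul_add])
    (fun c α Φ => by ext ψ; simp [owedge])

theorem owedgeₗ_apply (α : ExteriorAlgebra ℂ W) (Φ : Module.End ℂ W) :
    owedgeₗ W α Φ = owedge α Φ := rfl

/-- In the sum over an orthonormal frame only the components of the curvature along the null space
of `η` survive; this holds for any bilinear product of the form part and the endomorphism part. -/
theorem sum_orthonormalBasis_eq [FiniteDimensional ℂ W] {ι : Type*} [Fintype ι] {n : ℕ}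
    (hγ : ∀ X Y : V, γ X * γ Y + γ Y * γ X =
      ((-2 * inner ℝ X Y : ℝ) : ℂ) • (1 : Module.End ℂ W))
    {gs : Module.End ℂ W} {w : ℂ} {C : LinearMap.BilinForm ℂ W} {Δ₀ Δ₁ : ℤˣ} {η : W}
    {e f : Fin n → ℂ ⊗[ℝ] V}
    (h : IsPureSpinorFrame (fun i => cliffordC γ (e i)) (fun i => cliffordC γ (f i)) gs w C Δ₀ Δ₁ η)
    (hgs : ∀ x, gs * cliffordC γ x = -(cliffordC γ x * gs))
    (R : V →ₗ[ℝ] V →ₗ[ℝ] Module.End ℂ W) (b : OrthonormalBasis ι ℝ V)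
    {A : Type*} [AddCommGroup A] [Module ℂ A]
    (P : ExteriorAlgebra ℂ W →ₗ[ℂ] Module.End ℂ W →ₗ[ℂ] A) :
    ∑ μ, ∑ ν, P (ExteriorAlgebra.ι ℂ (γ (b μ) η) * ExteriorAlgebra.ι ℂ (γ (b ν) η))
        (R (b μ) (b ν)) =
      (4 : ℂ) • ∑ i, ∑ j, P (ExteriorAlgebra.ι ℂ (cliffordC γ (f i) η) *
        ExteriorAlgebra.ι ℂ (cliffordC γ (f j) η)) (curvC R (e i) (e j)) := by
  have hb : ∀ μ, γ (b μ) η =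
      ∑ i, (-2 * (complexBasis b).repr (e i) μ) • cliffordC γ (f i) η := fun μ => by
    refine h.eq_sum ?_ fun i => ?_
    · have := congr($(hgs (1 ⊗ₜ b μ)) η)
      simpa [cliffordC_tmul, h.chirality_apply] using this
    · have := congr($(cliffordC_mul_add_mul hγ b (e i) μ) η)
      simpa [h.annihilates i] using this
  have hR : ∀ i j, curvC R (e i) (e j) = ∑ μ, ∑ ν, ((complexBasis b).repr (e i) μ *
      (complexBasis b).repr (e j) ν) • R (b μ) (b ν) := fun i j => by
    conv_lhs => rw [← (complexBasis b).sum_repr (e i), ← (complexBasis b).sum_repr (e j)]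
    simp only [map_sum, map_smul, LinearMap.sum_apply, LinearMap.smul_apply, complexBasis_apply,
      curvC_one_tmul, Finset.smul_sum, smul_smul]
    rw [Finset.sum_comm]
    simp only [mul_comm]
  simp only [hb, hR, map_sum, map_smul, Finset.sum_mul_sum, smul_mul_smul_comm,
    LinearMap.sum_apply, LinearMap.smul_apply, Finset.smul_sum, smul_smul]
  have hswap (F : ι → ι → Fin n → Fin n → A) :
      ∑ μ, ∑ ν, ∑ i, ∑ j, F μ ν i j = ∑ i, ∑ j, ∑ μ, ∑ ν, F μ ν i j := by
    simpa only [Fintype.sum_prod_type] using Finset.sum_comm (s := Finset.univ) (t := Finset.univ)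
      (f := fun (p : ι × ι) (q : Fin n × Fin n) => F p.1 p.2 q.1 q.2)
  rw [hswap]
  refine Finset.sum_congr rfl fun i _ => Finset.sum_congr rfl fun j _ =>
    Finset.sum_congr rfl fun μ _ => Finset.sum_congr rfl fun ν _ => ?_
  congr 1
  ring

end Brackets

/-! ### The equivalence at a point -/

section Pointwise

variable {V : Type*} [NormedAddCommGroup V] [InnerProductSpace ℝ V]
  {W : Type*} [AddCommGroup W] [Module ℂ W] {γ : V →ₗ[ℝ] Module.End ℂ W}

/-- The components of `ε^{a₁ … a_n} γ_{a₁ … a_{n-2}} (1 - (-1)^n w_η γ^*)` are the two-vectors of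
the frame, up to one common factor. -/
theorem exists_gammaFactor_eq [FiniteDimensional ℂ W] {n : ℕ} (hn : 2 ≤ n)
    {gs : Module.End ℂ W} {w : ℂ} {C : LinearMap.BilinForm ℂ W} {Δ₀ Δ₁ : ℤˣ} {η : W}
    {e f : Fin n → ℂ ⊗[ℝ] V}
    (h : IsPureSpinorFrame (fun i => cliffordC γ (e i)) (fun i => cliffordC γ (f i)) gs w C Δ₀ Δ₁ η) :
    ∃ k : ℂ, k ≠ 0 ∧ ∀ σ : Equiv.Perm (Fin n),
      ((Equiv.Perm.sign σ : ℤ) : ℂ) • gammaFactor γ gs w e σ =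
        k • wedgeEnd C (cliffordC γ (f (σ ⟨n - 2, by omega⟩)) η)
          (cliffordC γ (f (σ ⟨n - 1, by omega⟩)) η) := by
  obtain ⟨k, hk, H⟩ := h.exists_prod_mul_eq_wedgeEnd hn
  refine ⟨k, hk, fun σ => ?_⟩
  rw [gammaFactor, gammaSkew_eq_prod fun i j => h.anticomm _ _, H σ, smul_smul, ← mul_assoc,
    ← Int.cast_mul, ← Units.val_mul, Int.units_mul_self, Units.val_one, Int.cast_one, one_mul]

/-- The sum over all permutations, for any bilinear product, as a sum over the frame. -/
theorem exists_sum_perm_eq [FiniteDimensional ℂ W] {n : ℕ} (hn : 2 ≤ n)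
    {gs : Module.End ℂ W} {w : ℂ} {C : LinearMap.BilinForm ℂ W} {Δ₀ Δ₁ : ℤˣ} {η : W}
    {e f : Fin n → ℂ ⊗[ℝ] V}
    (h : IsPureSpinorFrame (fun i => cliffordC γ (e i)) (fun i => cliffordC γ (f i)) gs w C Δ₀ Δ₁ η)
    (R : V →ₗ[ℝ] V →ₗ[ℝ] Module.End ℂ W) :
    ∃ k : ℂ, k ≠ 0 ∧ ∀ {A : Type _} [AddCommGroup A] [Module ℂ A]
      (P : Module.End ℂ W →ₗ[ℂ] Module.End ℂ W →ₗ[ℂ] A),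
      ∑ σ : Equiv.Perm (Fin n), ((Equiv.Perm.sign σ : ℤ) : ℂ) •
        P (gammaFactor γ gs w e σ) (curvFactor hn R e σ) =
      k • ∑ i, ∑ j, P (wedgeEnd C (cliffordC γ (f i) η) (cliffordC γ (f j) η))
        (curvC R (e i) (e j)) := by
  obtain ⟨k, hk, H⟩ := exists_gammaFactor_eq hn h
  obtain ⟨N, hN, hsum⟩ := sum_perm_apply_two (ι := Fin n) (i := ⟨n - 2, by omega⟩)
    (j := ⟨n - 1, by omega⟩) (by simp only [ne_eq, Fin.mk.injEq]; omega)
  refine ⟨k * N, mul_ne_zero hk (Nat.cast_ne_zero.2 hN), fun {A} _ _ P => ?_⟩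
  rw [mul_smul, Nat.cast_smul_eq_nsmul ℂ, ← hsum (fun i j => P (wedgeEnd C (cliffordC γ (f i) η)
    (cliffordC γ (f j) η)) (curvC R (e i) (e j))) fun i => by simp [wedgeEnd_self],
    Finset.smul_sum]
  refine Finset.sum_congr rfl fun σ _ => ?_
  rw [← LinearMap.smul_apply, ← map_smul, H, map_smul, LinearMap.smul_apply]
  rfl

/-- The equivalence for the curvature tensor `R` at a point, with both meanings of the product. -/
theorem bracketB_eq_zero_iff [FiniteDimensional ℝ V] [FiniteDimensional ℂ W] {n : ℕ} (hn : 2 ≤ n)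
    (hγ : ∀ X Y : V, γ X * γ Y + γ Y * γ X =
      ((-2 * inner ℝ X Y : ℝ) : ℂ) • (1 : Module.End ℂ W))
    {gs : Module.End ℂ W} {w : ℂ} {C : LinearMap.BilinForm ℂ W} (hC : C.Nondegenerate)
    {Δ₀ Δ₁ : ℤˣ} {η : W} {e f : Fin n → ℂ ⊗[ℝ] V}
    (h : IsPureSpinorFrame (fun i => cliffordC γ (e i)) (fun i => cliffordC γ (f i)) gs w C Δ₀ Δ₁ η)
    (hgs : ∀ x, gs * cliffordC γ x = -(cliffordC γ x * gs))
    (R : V →ₗ[ℝ] V →ₗ[ℝ] Module.End ℂ W) :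
    (bracketB γ R η η = 0 ↔ epsilonSum hn C hC γ gs w R e = 0) ∧
      (bracketBTensor γ R η η = 0 ↔ epsilonSumTensor hn γ gs w R e = 0) := by
  obtain ⟨k, hk, hε⟩ := exists_sum_perm_eq hn h R
  have hB {A : Type _} [AddCommGroup A] [Module ℂ A]
      (P : ExteriorAlgebra ℂ W →ₗ[ℂ] Module.End ℂ W →ₗ[ℂ] A) :=
    sum_orthonormalBasis_eq hγ h hgs R (stdOrthonormalBasis ℝ V) P
  constructor
  · have h1 : epsilonSum hn C hC γ gs w R e = (k * 2⁻¹) • bracketB γ R η η := by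
      have h2 := hB (owedgeₗ W)
      have h3 := hε (owedgeₗ W ∘ₗ twoVectorₗ C hC)
      simp only [LinearMap.comp_apply, twoVectorₗ_apply, twoVector_wedgeEnd, map_smul,
        LinearMap.smul_apply, ← Finset.smul_sum, owedgeₗ_apply] at h2 h3
      rw [epsilonSum, h3, bracketB, h2, smul_smul, smul_smul]
      congr 1
      ring
    rw [h1, smul_eq_zero, or_iff_right (mul_ne_zero hk (by norm_num))]
  · have h2 : bracketBTensor γ R η η = _ := hB (TensorProduct.mk ℂ _ _)
    have h3 : epsilonSumTensor hn γ gs w R e = _ := hε (TensorProduct.mk ℂ _ _)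
    rw [h2, h3, smul_eq_zero, smul_eq_zero, or_iff_right hk, or_iff_right (by norm_num : (4 : ℂ) ≠ 0)]
    constructor <;> intro h0
    · have h4 := congrArg (LinearMap.rTensor (Module.End ℂ W) (wedgeToEnd C)) h0
      simpa only [map_sum, TensorProduct.mk_apply, LinearMap.rTensor_tmul, wedgeToEnd_ι_mul_ι,
        map_zero] using h4
    · have h4 := congrArg (LinearMap.rTensor (Module.End ℂ W) (twoVectorₗ C hC)) h0
      simp only [map_sum, TensorProduct.mk_apply, LinearMap.rTensor_tmul, twoVectorₗ_apply,
        twoVector_wedgeEnd, map_zero, ← TensorProduct.smul_tmul', ← Finset.smul_sum] at h4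
      exact (smul_eq_zero.1 h4).resolve_left two_ne_zero

end Pointwise

theorem proposition5p6 {n : ℕ} (hn : 2 ≤ n)
    {M : Type*} [TopologicalSpace M] [T2Space M]
    [ChartedSpace (EuclideanSpace ℝ (Fin (2 * n))) M] [IsManifold (𝓡 (2 * n)) ∞ M]
    [RiemannianBundle (fun x : M => TangentSpace (𝓡 (2 * n)) x)]
    [IsContMDiffRiemannianBundle (𝓡 (2 * n)) ∞ (EuclideanSpace ℝ (Fin (2 * n)))
      (fun x : M => TangentSpace (𝓡 (2 * n)) x)]
    {F : Type*} [NormedAddCommGroup F] [NormedSpace ℂ F]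
    {S : M → Type*} [∀ x, AddCommGroup (S x)] [∀ x, Module ℂ (S x)]
    [∀ x, TopologicalSpace (S x)]
    [∀ x, IsTopologicalAddGroup (S x)] [∀ x, ContinuousSMul ℝ (S x)]
    [TopologicalSpace (TotalSpace F S)] [FiberBundle F S]
    [VectorBundle ℂ F S] [VectorBundle ℝ F S] [ContMDiffVectorBundle ∞ F S (𝓡 (2 * n))]
    (𝒮 : SpinorBundle n M F S) (D : ComplexConnection n M F S)
    (η : (x : M) → S x)
    (_hη : ContMDiff (𝓡 (2 * n)) ((𝓡 (2 * n)).prod 𝓘(ℝ, F)) ∞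
      (fun x => TotalSpace.mk' F x (η x)))
    (_hpure : ∀ x, IsPureSpinor n (𝒮.γ x) (η x))
    (e : ∀ x, Module.Basis (Fin n) ℂ (nullSpace (𝒮.γ x) (η x))) :
    -- pure spinors are chiral, so that `w_η` is really defined by `γ^* η = w_η η`
    (∀ x, 𝒮.chirality hn x (η x) = 𝒮.sign hn η x • η x) ∧
    -- the equivalence for the vector fields on the supermanifold, pointwise and globally
    (∀ x, 𝒮.B D η x = 0 ↔ 𝒮.epsilonSum hn D η x (e x) = 0) ∧
    ((∀ x, 𝒮.B D η x = 0) ↔ ∀ x, 𝒮.epsilonSum hn D η x (e x) = 0) ∧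
    -- the equivalence with tensor products
    (∀ x, 𝒮.BTensor D η x = 0 ↔ 𝒮.epsilonSumTensor hn D η x (e x) = 0) ∧
    ((∀ x, 𝒮.BTensor D η x = 0) ↔ ∀ x, 𝒮.epsilonSumTensor hn D η x (e x) = 0) := by
  have hS (x : M) := 𝒮.finiteDimensional_fiber x
  have hframe (x : M) := exists_isPureSpinorFrame (by omega) (𝒮.clifford x)
    (by rw [VectorBundle.finrank_eq ℂ F S x, 𝒮.rank_eq]) (𝒮.C_nondegenerate x) (𝒮.C_symm x)
    (𝒮.C_γ_symm x)
    ((𝒮.orientation x).finOrthonormalBasis (by omega) finrank_euclideanSpace_fin) (_hpure x) (e x)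
  have key (x : M) := (hframe x).elim fun f hf => bracketB_eq_zero_iff hn (𝒮.clifford x)
    (𝒮.C_nondegenerate x) hf (chiralityOp_mul_cliffordC (𝒮.clifford x) _) (D.curvature x)
  exact ⟨fun x => (hframe x).elim fun f hf => hf.chirality_apply, fun x => (key x).1,
    forall_congr' fun x => (key x).1, fun x => (key x).2, forall_congr' fun x => (key x).2⟩
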